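/- **Entanglement-based bound for short-time evolution of observable error.** *Setting.* Let $H=\sum_{l=1}^L H_l$ with $H_1,\dots,H_L$ Hermitian operators on $N$ qubits, $d=2^N$. A product formula is given by stages $(a_s,\pi_s)$, $s=1,\dots,S$, with $a_s\in\mathbb R$ and $\pi_s$ the identity or the reversal of $\{1,\dots,L\}$: $$\mathscr U(t)=\prod_{s=1}^S\prod_{l=1}^L e^{-i t a_s H_{\pi_s(l)}}.$$ It has order $p$ for $H$ if $\mathscr U(t)-e^{-iHt}=\mathcal O(t^{p+1})$ as $t\to0$. Its multiplicative error $\mathscr M(t)$ is defined by $\mathscr U(t)=e^{-iHt}(I+\mathscr M(t))$. Let $\|\cdot\|$ be the spectral norm, $\|A\|_F^2=\operatorname{tr}(A^\dagger A)/d$, and $$\alpha_{p+2}=\sum_{l_1,\dots,l_{p+2}=1}^L\big\|[H_{l_1},[H_{l_2},\dots,[H_{l_{p+1}},H_{l_{p+2}}]]]\big\|.$$ For an operator $B$ let $\operatorname{supp}(B)$ be the set of qubits on which $B$ acts nontrivially and $d_{\operatorname{supp}(B)}=2^{|\operatorname{supp}(B)|}$. For a decomposition $A=\sum_jA_j$ and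 a vector $|\chi\rangle$ let $$\Delta_A(|\chi\rangle)=\sum_{j,j'}\|A_j^\dagger A_{j'}\|\sqrt{2\log d_{\operatorname{supp}(A_j^\dagger A_{j'})}-2S(\rho_{j,j'})},$$ where $\rho_{j,j'}$ is the reduction of $|\chi\rangle\langle\chi|$ to $\operatorname{supp}(A_j^\dagger A_{j'})$ and $S(\rho)=-\operatorname{tr}(\rho\log\rho)$, with natural logarithms. *Claims.* (a) The first-order formula $e^{-iH_1t}\cdots e^{-iH_Lt}$ has order $1$. The second-order formula $\mathscr U_2(t)=e^{-iH_1t/2}\cdots e^{-iH_Lt/2}\,e^{-iH_Lt/2}\cdots e^{-iH_1t/2}$ has order $2$, and for $k>1$ Suzuki's formula $\mathscr U_{2k}(t)=\mathscr U_{2k-2}(p_kt)^2\,\mathscr U_{2k-2}((1-4p_k)t)\,\mathscr U_{2k-2}(p_kt)^2$, $p_k=1/(4-4^{1/(2k-1)})$, has order $2k$. (b) Let $p\ge1$ and let stages be given. There is a constant $C$, depending only on $p$ and the stages, such that the following holds for all $N$, $L$ and $H_1,\dots,H_L$ as above for which the product formula $\mathscr U_p$ with these stages has order $p$. There are an operator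 $M$ and a $t_0>0$ such that for all $0<\delta t\le t_0$ $$\|\mathscr M(\delta t)-M\delta t^{p+1}\|\le C\,\alpha_{p+2}\,\delta t^{p+2},$$ and for every observable (Hermitian operator) $O$, all finite decompositions $O=\sum_jO_j$ and $M=\sum_jM_j$, every unit vector $|\psi\rangle$ and all $0<\delta t\le t_0$, the error $\epsilon_O=|\langle\psi|e^{iH\delta t}Oe^{-iH\delta t}-\mathscr U_p(\delta t)^\dagger O\,\mathscr U_p(\delta t)|\psi\rangle|$ satisfies $$\epsilon_O\le\Big[\sqrt{\|O\|_F^2+\Delta_O(|\psi(\delta t)\rangle)}\sqrt{\|M\|_F^2+\Delta_M(|\psi_{O(\delta t)}\rangle)}+\sqrt{\|O\|_F^2+\Delta_O(|\psi_{U(\delta t)M}\rangle)}\sqrt{\|M\|_F^2+\Delta_M(|\psi\rangle)}\Big]\delta t^{p+1}+2C\|O\|\alpha_{p+2}\,\delta t^{p+2}.$$ Here $|\psi(\delta t)\rangle=e^{-iH\delta t}|\psi\rangle$, $O(\delta t)=e^{iH\delta t}Oe^{-iH\delta t}$, $|\psi_{O(\delta t)}\rangle=O(\delta t)|\psi\rangle/\|O(\delta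 t)|\psi\rangle\|$, $|\psi_M\rangle=M|\psi\rangle/\|M|\psi\rangle\|$ and $|\psi_{U(\delta t)M}\rangle=e^{-iH\delta t}|\psi_M\rangle$; a normalized vector is read as $0$ where its denominator vanishes. (c) In the situation of (b), let $\kappa\ge0$ and suppose that the local entanglement is near-maximal, that is, $$S(\rho_{j,j'})\ge\log d_{\operatorname{supp}(A_j^\dagger A_{j'})}-\kappa\,\frac{\|A\|_F^4}{(\sum_i\|A_i\|)^4}\quad\text{for all }j,j'$$ (the fraction being read as $0$ if all $A_i=0$), for $A=O$ in the states $|\psi(\delta t)\rangle$ and $|\psi_{U(\delta t)M}\rangle$ and for $A=M$ in the states $|\psi_{O(\delta t)}\rangle$ and $|\psi\rangle$. Then $$\epsilon_O\le2\big(1+\sqrt{2\kappa}\big)\|O\|_F\|M\|_F\,\delta t^{p+1}+2C\|O\|\alpha_{p+2}\,\delta t^{p+2}.$$ -/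

import Mathlib

open scoped Matrix Matrix.Norms.L2Operator Topology

noncomputable section

namespace Trotter

/-! ### Qubits: operators and states -/

/-- Labels of the computational basis of `N` qubits. -/
abbrev Basis (N : ℕ) : Type := Fin N → Fin 2

/-- Linear operators on `N` qubits; `‖A‖` is the spectral (operator) norm. -/
abbrev Op (N : ℕ) : Type := Matrix (Basis N) (Basis N) ℂ

/-- Vectors of the `N`-qubit Hilbert space, with the Euclidean inner product. -/
abbrev Ket (N : ℕ) : Type := EuclideanSpace ℂ (Basis N)

/-- The vector `A|χ⟩`. -/
def act {N : ℕ} (A : Op N) (χ : Ket N) : Ket N := Matrix.toEuclideanLin A χ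

/-- The square of the normalized Frobenius norm, `tr(A†A) / 2^N`. -/
def frobSq {N : ℕ} (A : Op N) : ℝ := (Matrix.trace (Aᴴ * A)).re / 2 ^ N

/-- The normalized Frobenius norm. -/
def frob {N : ℕ} (A : Op N) : ℝ := √(frobSq A)

/-! ### Supports, reduced density matrices, entanglement entropy -/

/-- The operator `B ⊗ 1` that acts as `B` on the qubits in `T` and trivially on all others. -/
def localOp {N : ℕ} (T : Finset (Fin N)) (B : Matrix (T → Fin 2) (T → Fin 2) ℂ) : Op N :=
  Matrix.of fun x y =>
    if ∀ i, i ∉ T → x i = y i then B (fun i => x i) (fun i => y i) else 0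

open Classical in
/-- The support of `A`: all qubits `i` on which `A` acts nontrivially, that is, `A` is not of the
form (operator on the other qubits) ⊗ (identity on qubit `i`). -/
def supp {N : ℕ} (A : Op N) : Finset (Fin N) :=
  Finset.univ.filter fun i => ¬ ∃ B, A = localOp {i}ᶜ B

/-- The basis label that is `x` on the qubits in `T` and `z` on the others. -/
def glue {N : ℕ} (T : Finset (Fin N)) (x : T → Fin 2) (z : {i // i ∉ T} → Fin 2) : Basis N :=
  fun i => if h : i ∈ T then x ⟨i, h⟩ else z ⟨i, h⟩

/-- The partial trace over all qubits outside `T`. -/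
def partialTrace {N : ℕ} (T : Finset (Fin N)) (ρ : Op N) : Matrix (T → Fin 2) (T → Fin 2) ℂ :=
  Matrix.of fun x y => ∑ z : {i // i ∉ T} → Fin 2, ρ (glue T x z) (glue T y z)

/-- The rank-one operator `|χ⟩⟨χ|`. -/
def ketBra {N : ℕ} (χ : Ket N) : Op N := Matrix.of fun x y => χ x * star (χ y)

/-- The reduced density matrix of `|χ⟩⟨χ|` on the qubits in `T`. -/
def reduced {N : ℕ} (T : Finset (Fin N)) (χ : Ket N) : Matrix (T → Fin 2) (T → Fin 2) ℂ :=
  partialTrace T (ketBra χ)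

theorem reduced_isHermitian {N : ℕ} (T : Finset (Fin N)) (χ : Ket N) :
    (reduced T χ).IsHermitian := by
  ext x y
  simp [reduced, partialTrace, ketBra, Matrix.conjTranspose_apply, mul_comm]

/-- The von Neumann entropy `-tr(ρ log ρ)`, with the natural logarithm. -/
def entropy {n : Type*} [Fintype n] [DecidableEq n] {ρ : Matrix n n ℂ} (hρ : ρ.IsHermitian) : ℝ :=
  ∑ i, Real.negMulLog (hρ.eigenvalues i)

/-- The entanglement entropy of the reduction of `|χ⟩⟨χ|` to the qubits in `T`. -/
def entEntropy {N : ℕ} (T : Finset (Fin N)) (χ : Ket N) : ℝ := entropy (reduced_isHermitian T χ)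

/-- `log d_T`, where `d_T = 2 ^ |T|` is the dimension of the subsystem `T`. -/
def logDim {N : ℕ} (T : Finset (Fin N)) : ℝ := Real.log (2 ^ T.card)

/-- `Δ_A(|χ⟩)` for the decomposition `A = ∑ j, A j`. -/
def entDelta {N J : ℕ} (A : Fin J → Op N) (χ : Ket N) : ℝ :=
  ∑ j, ∑ j', ‖(A j)ᴴ * A j'‖ *
    √(2 * logDim (supp ((A j)ᴴ * A j')) - 2 * entEntropy (supp ((A j)ᴴ * A j')) χ)

/-- The entanglement entropies of `χ` on all the subsystems `supp (A j† A j')` are maximal up to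
`κ ‖A‖_F⁴ / (∑ j, ‖A j‖)⁴`, where `A = ∑ j, A j`. -/
def NearMaxEntangled {N J : ℕ} (κ : ℝ) (A : Fin J → Op N) (χ : Ket N) : Prop :=
  ∀ j j', logDim (supp ((A j)ᴴ * A j')) - κ * frob (∑ i, A i) ^ 4 / (∑ i, ‖A i‖) ^ 4
    ≤ entEntropy (supp ((A j)ᴴ * A j')) χ

/-! ### Time evolution and product formulas -/

/-- `e^{-i t A}`. -/
def evol {N : ℕ} (A : Op N) (t : ℝ) : Op N := NormedSpace.exp ((-(Complex.I * (t : ℂ))) • A)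

/-- The Heisenberg evolution `e^{i t H} O e^{-i t H}`. -/
def heisenberg {N : ℕ} (H O : Op N) (t : ℝ) : Op N := evol H (-t) * O * evol H t

/-- One stage `(a, b)` of a product formula: the product of the `e^{-i t a H_l}`, with increasing
`l` from left to right if `b = false`, with decreasing `l` if `b = true`. -/
def stage {N L : ℕ} (H : Fin L → Op N) (t : ℝ) (s : ℝ × Bool) : Op N :=
  let factors := List.ofFn fun l => evol (H l) (s.1 * t)
  if s.2 then factors.reverse.prod else factors.prod

/-- The product formula with the list of stages `F`; the first stage is the leftmost factor. -/
def prodFormula {N L : ℕ} (F : List (ℝ × Bool)) (H : Fin L → Op N) (t : ℝ) : Op N :=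
  (F.map (stage H t)).prod

/-- The product formula `F` has order (at least) `p` for the Hamiltonian `∑ l, H l`. -/
def HasOrder {N L : ℕ} (p : ℕ) (F : List (ℝ × Bool)) (H : Fin L → Op N) : Prop :=
  (fun t : ℝ => prodFormula F H t - evol (∑ l, H l) t) =O[𝓝 0] fun t : ℝ => t ^ (p + 1)

/-- The first-order product formula. -/
def pf1 : List (ℝ × Bool) := [(1, false)]

/-- All the times of a product formula are multiplied by `c`. -/
def scale (c : ℝ) (F : List (ℝ × Bool)) : List (ℝ × Bool) := F.map fun s => (c * s.1, s.2)

/-- `pf2k m` is the Suzuki formula of order `2 k`, `k = m + 1`: the second-order formula for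
`k = 1`, and for `k > 1` the recursion with `p_k = 1 / (4 - 4 ^ (1 / (2 k - 1)))`. -/
def pf2k : ℕ → List (ℝ × Bool)
  | 0 => [(1 / 2, false), (1 / 2, true)]
  | m + 1 =>
    let q : ℝ := 1 / (4 - (4 : ℝ) ^ (1 / (2 * (m : ℝ) + 3)))
    let F := pf2k m
    scale q (F ++ F) ++ scale (1 - 4 * q) F ++ scale q (F ++ F)

/-- The nested commutator `[A 0, [A 1, …, [A (n-1), A n]]]`. -/
def nestedComm {N : ℕ} : (n : ℕ) → (Fin (n + 1) → Op N) → Op N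
  | 0, A => A 0
  | n + 1, A => ⁅A 0, nestedComm n (fun i => A i.succ)⁆

/-- `alpha n H = ∑_{l_0, …, l_n} ‖[H_{l_0}, [H_{l_1}, …, [H_{l_{n-1}}, H_{l_n}]]]‖`,
a sum over `n + 1` indices. -/
def alpha {N L : ℕ} (n : ℕ) (H : Fin L → Op N) : ℝ :=
  ∑ l : Fin (n + 1) → Fin L, ‖nestedComm n (fun i => H (l i))‖

/-- The multiplicative error `ℳ(t)`: the product formula equals `e^{-i t H} (1 + ℳ(t))`. -/
def multError {N L : ℕ} (F : List (ℝ × Bool)) (H : Fin L → Op N) (t : ℝ) : Op N :=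
  evol (∑ l, H l) (-t) * prodFormula F H t - 1

/-- The error of the observable `O` in one step,
`|⟨ψ| e^{i t H} O e^{-i t H} - U† O U |ψ⟩|` with `U` the product formula. -/
def obsError {N L : ℕ} (F : List (ℝ × Bool)) (H : Fin L → Op N) (O : Op N) (ψ : Ket N)
    (t : ℝ) : ℝ :=
  ‖inner ℂ ψ (act (heisenberg (∑ l, H l) O t
    - (prodFormula F H t)ᴴ * O * prodFormula F H t) ψ)‖

/-- `|ψ(t)⟩ = e^{-i t H}|ψ⟩`. -/
def psiT {N : ℕ} (H : Op N) (ψ : Ket N) (t : ℝ) : Ket N := act (evol H t) ψ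

/-- The normalized vector `O(t)|ψ⟩ / ‖O(t)|ψ⟩‖` (zero if `O(t)|ψ⟩ = 0`). -/
def psiO {N : ℕ} (H O : Op N) (ψ : Ket N) (t : ℝ) : Ket N :=
  NormedSpace.normalize (act (heisenberg H O t) ψ)

/-- `e^{-i t H}` applied to the normalized vector `M|ψ⟩ / ‖M|ψ⟩‖` (zero if `M|ψ⟩ = 0`). -/
def psiUM {N : ℕ} (H M : Op N) (ψ : Ket N) (t : ℝ) : Ket N :=
  act (evol H t) (NormedSpace.normalize (act M ψ))

end Trotter

end

open Trotter

/-! Multiplicative error. The operator `W(t) = e^{iHt} U(t) = 1 + ℳ(t)` is itself a product of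
exponentials, so it can be treated as a formal power series. Under the Euler derivation `X d/dX` it
satisfies `W' = W G`. Each summand of `G` is an exponent conjugated by the exponentials to its
right, so the degree `k+1` coefficient of `G` is a combination of `k`-fold commutators. Order `p`
means that the coefficients `w_1, …, w_p` of `W` vanish. Because `p ≥ 1`, also `g_1 = 0`, and
comparing coefficients in `W' = W G` leaves `(p+2) w_{p+2} = g_{p+2}`. This is bounded by a constant
times `alpha (p+1) H`. The operator `M` is `w_{p+1}`. The terms beyond degree `p+2` have no
commutator bound, but a small `t₀` absorbs them into `alpha`, provided `alpha > 0`. If `alpha = 0`,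
hermiticity forces all `H_l` to commute, and then the formula is exact (`exists_multError_bound`).
Observable error. With `Q = e^{iHt} O e^{-iHt}` and `W` unitary, `Q - W†QW = W†[ℳ, Q]`. The error is
therefore at most `‖ℳQψ‖ + ‖Qℳψ‖` (`obsError_le_commutator`), and replacing `ℳ` by `t^{p+1} M`
leaves norms of the form `‖Aχ‖`. Expand `‖Aχ‖²` into expectations of `A_j†A_j'`. Each differs from
its normalized trace by at most its norm times the trace distance of the reduced state from the
maximally mixed one, and Pinsker's inequality bounds that distance by the entropy defect
(`norm_act_le_sqrt`). The normalized traces add up to the squared Frobenius norm. Orders. Leading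
errors add under composition. Suzuki's coefficients cancel the leading error, and time-reversal
symmetry excludes an error term of even degree. -/

namespace Trotter

/-! ### Everywhere convergent power series: passing between functions and coefficients. -/

section Entire

open PowerSeries Asymptotics

variable {𝔸 : Type*} [NormedRing 𝔸] [NormedAlgebra ℂ 𝔸]

/-- `f` is the sum of the everywhere absolutely convergent power series `φ`. -/
def IsEntireSum (f : ℝ → 𝔸) (φ : PowerSeries 𝔸) : Prop :=
  ∀ t : ℝ, Summable (fun k => ‖(t : ℂ) ^ k • coeff k φ‖) ∧ f t = ∑' k, (t : ℂ) ^ k • coeff k φ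

/-- The formal power series of `t ↦ exp (t B)`. -/
noncomputable def expSeries (B : 𝔸) : PowerSeries 𝔸 := PowerSeries.mk fun k => ((k.factorial : ℂ)⁻¹) • B ^ k

theorem coeff_expSeries (B : 𝔸) (k : ℕ) :
    coeff k (expSeries B) = ((k.factorial : ℂ)⁻¹) • B ^ k := by
  simp [expSeries]

theorem isEntireSum_one : IsEntireSum (fun _ => (1 : 𝔸)) 1 := by
  intro t
  have h : ∀ k, k ≠ 0 → (t : ℂ) ^ k • coeff k (1 : PowerSeries 𝔸) = 0 := by
    intro k hk; simp [PowerSeries.coeff_one, hk]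
  refine ⟨summable_of_ne_finset_zero (s := {0}) fun k hk => ?_, ?_⟩
  · rw [h k (by simpa using hk), norm_zero]
  · rw [tsum_eq_single 0 h]; simp

theorem IsEntireSum.mul [CompleteSpace 𝔸] {f g : ℝ → 𝔸} {φ ψ : PowerSeries 𝔸} (hf : IsEntireSum f φ)
    (hg : IsEntireSum g ψ) : IsEntireSum (fun t => f t * g t) (φ * ψ) := by
  intro t
  have key : ∀ k, (t : ℂ) ^ k • coeff k (φ * ψ) = ∑ ij ∈ Finset.HasAntidiagonal.antidiagonal k,
      ((t : ℂ) ^ ij.1 • coeff ij.1 φ) * ((t : ℂ) ^ ij.2 • coeff ij.2 ψ) := by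
    intro k
    rw [PowerSeries.coeff_mul, Finset.smul_sum]
    refine Finset.sum_congr rfl fun ij hij => ?_
    rw [smul_mul_assoc, mul_smul_comm, smul_smul, ← pow_add,
      Finset.HasAntidiagonal.mem_antidiagonal.1 hij]
  have h1 := summable_norm_sum_mul_antidiagonal_of_summable_norm (hf t).1 (hg t).1
  have h2 := tsum_mul_tsum_eq_tsum_sum_antidiagonal_of_summable_norm (hf t).1 (hg t).1
  rw [← (hf t).2, ← (hg t).2] at h2
  exact ⟨h1.congr fun k => by rw [key], h2.trans (tsum_congr fun k => (key k).symm)⟩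

theorem isEntireSum_exp [CompleteSpace 𝔸] (B : 𝔸) :
    IsEntireSum (fun t : ℝ => NormedSpace.exp ((t : ℂ) • B)) (expSeries B) := by
  intro t
  have key : ∀ k, (t : ℂ) ^ k • coeff k (expSeries B)
      = ((k.factorial : ℂ)⁻¹) • ((t : ℂ) • B) ^ k := by
    intro k
    rw [coeff_expSeries, smul_pow, smul_comm]
  simp_rw [key]
  exact ⟨NormedSpace.norm_expSeries_summable' (𝕂 := ℂ) _,
    congrFun (NormedSpace.exp_eq_tsum (𝕂 := ℂ)) _⟩

theorem IsEntireSum.remainder [CompleteSpace 𝔸] {f : ℝ → 𝔸} {φ : PowerSeries 𝔸} (hf : IsEntireSum f φ) (n : ℕ) :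
    ∃ K : ℝ, 0 ≤ K ∧ ∀ t : ℝ, |t| ≤ 1 →
      ‖f t - ∑ k ∈ Finset.range n, (t : ℂ) ^ k • coeff k φ‖ ≤ K * |t| ^ n := by
  -- Absolute convergence at `t = 1` dominates the tail uniformly on `|t| ≤ 1`.
  have h1 : Summable fun k => ‖coeff k φ‖ := by simpa using (hf 1).1
  have h2 : Summable fun k => ‖coeff (k + n) φ‖ := (summable_nat_add_iff n).2 h1
  refine ⟨∑' k, ‖coeff (k + n) φ‖, tsum_nonneg fun _ => norm_nonneg _, fun t ht => ?_⟩
  rw [(hf t).2, ← (hf t).1.of_norm.sum_add_tsum_nat_add n, add_sub_cancel_left]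
  refine tsum_of_norm_bounded (h2.hasSum.mul_right (|t| ^ n)) fun k => ?_
  rw [norm_smul, norm_pow, Complex.norm_real, Real.norm_eq_abs, pow_add, mul_comm]
  gcongr
  calc |t| ^ k * |t| ^ n ≤ 1 * |t| ^ n := by
        gcongr; exact pow_le_one₀ (abs_nonneg t) ht
    _ = |t| ^ n := one_mul _

theorem IsEntireSum.remainder_isBigO [CompleteSpace 𝔸] {f : ℝ → 𝔸} {φ : PowerSeries 𝔸} (hf : IsEntireSum f φ)
    (n : ℕ) : (fun t : ℝ => f t - ∑ k ∈ Finset.range n, (t : ℂ) ^ k • coeff k φ)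
      =O[𝓝 0] fun t : ℝ => t ^ n := by
  obtain ⟨K, -, hK⟩ := hf.remainder n
  refine IsBigO.of_bound K ?_
  filter_upwards [Metric.closedBall_mem_nhds (0 : ℝ) one_pos] with t ht
  simpa using hK t (by simpa using ht)

/-- A nonzero `c` would give `t^n = O(t^(n+1))`, contradicting `t^(n+1) = o(t^n)` since `t^n` is
nonzero off the origin. -/
theorem eq_zero_of_pow_smul_isBigO {n : ℕ} {c : 𝔸}
    (h : (fun t : ℝ => (t : ℂ) ^ n • c) =O[𝓝 0] fun t : ℝ => t ^ (n + 1)) : c = 0 := by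
  by_contra hc
  have h2 : (fun t : ℝ => t ^ n) =O[𝓝 0] fun t : ℝ => t ^ (n + 1) := by
    refine IsBigO.trans (IsBigO.of_bound ‖c‖⁻¹ (Filter.Eventually.of_forall fun t => ?_)) h
    rw [norm_smul, norm_pow, norm_pow, Complex.norm_real]
    have : ‖c‖ ≠ 0 := norm_ne_zero_iff.2 hc
    field_simp; rfl
  have h3 : (fun t : ℝ => t ^ (n + 1)) =o[𝓝 0] fun t : ℝ => t ^ n :=
    isLittleO_pow_pow (Nat.lt_succ_self n)
  have h4 := h2.trans_isLittleO h3
  have h5 := (isLittleO_irrefl' (f' := fun t : ℝ => t ^ n) (l := 𝓝 (0 : ℝ)) ?_) h4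
  · exact h5
  · have : ∃ᶠ t : ℝ in 𝓝[≠] 0, ‖t ^ n‖ ≠ 0 :=
      Filter.Eventually.frequently <| by
        filter_upwards [self_mem_nhdsWithin] with t ht
        exact norm_ne_zero_iff.2 (pow_ne_zero _ ht)
    exact this.filter_mono nhdsWithin_le_nhds

theorem IsEntireSum.coeff_eq_zero [CompleteSpace 𝔸] {f : ℝ → 𝔸} {φ : PowerSeries 𝔸} (hf : IsEntireSum f φ) {n : ℕ}
    (h : f =O[𝓝 0] fun t : ℝ => t ^ n) {k : ℕ} (hk : k < n) : coeff k φ = 0 := by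
  induction k using Nat.strong_induction_on with
  | _ k ih =>
    refine eq_zero_of_pow_smul_isBigO (n := k) ?_
    have h1 := hf.remainder_isBigO (k + 1)
    have h2 : f =O[𝓝 0] fun t : ℝ => t ^ (k + 1) :=
      h.trans (IsBigO.of_bound 1 (by
        filter_upwards [Metric.closedBall_mem_nhds (0 : ℝ) one_pos] with t ht
        rw [norm_pow, norm_pow, one_mul]
        exact pow_le_pow_of_le_one (norm_nonneg _) (by simpa using ht) hk))
    refine (h2.sub h1).congr_left fun t => ?_
    rw [sub_sub_cancel, Finset.sum_range_succ, Finset.sum_eq_zero, zero_add]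
    intro j hj
    rw [ih j (Finset.mem_range.1 hj) (by have := Finset.mem_range.1 hj; omega), smul_zero]

theorem IsEntireSum.isBigO_of_coeff_eq_zero [CompleteSpace 𝔸] {f : ℝ → 𝔸} {φ : PowerSeries 𝔸}
    (hf : IsEntireSum f φ) {n : ℕ} (h : ∀ k < n, coeff k φ = 0) :
    f =O[𝓝 0] fun t : ℝ => t ^ n := by
  refine (hf.remainder_isBigO n).congr_left fun t => ?_
  rw [Finset.sum_eq_zero, sub_zero]
  intro k hk
  rw [h k (Finset.mem_range.1 hk), smul_zero]

theorem IsEntireSum.sub [CompleteSpace 𝔸] {f g : ℝ → 𝔸} {φ ψ : PowerSeries 𝔸} (hf : IsEntireSum f φ)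
    (hg : IsEntireSum g ψ) : IsEntireSum (fun t => f t - g t) (φ - ψ) := by
  intro t
  simp only [map_sub, smul_sub]
  refine ⟨((hf t).1.add (hg t).1).of_nonneg_of_le (fun _ => norm_nonneg _)
    fun _ => norm_sub_le _ _, ?_⟩
  rw [(hf t).2, (hg t).2, (hf t).1.of_norm.tsum_sub (hg t).1.of_norm]

end Entire

/-! ### Formal calculus: logarithmic derivatives of products of exponentials. -/

section Formal

open PowerSeries

variable {𝔸 : Type*} [NormedRing 𝔸] [NormedAlgebra ℂ 𝔸]

/-- The Euler derivation `X d/dX`. -/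
noncomputable def euler (φ : PowerSeries 𝔸) : PowerSeries 𝔸 :=
  PowerSeries.mk fun k => (k : ℂ) • coeff k φ

theorem coeff_euler (φ : PowerSeries 𝔸) (k : ℕ) : coeff k (euler φ) = (k : ℂ) • coeff k φ := by
  simp [euler]

theorem euler_mul (φ ψ : PowerSeries 𝔸) : euler (φ * ψ) = euler φ * ψ + φ * euler ψ := by
  ext k
  rw [map_add, coeff_euler, coeff_mul, coeff_mul, coeff_mul, Finset.smul_sum,
    ← Finset.sum_add_distrib]
  refine Finset.sum_congr rfl fun ij hij => ?_
  rw [coeff_euler, coeff_euler, smul_mul_assoc, mul_smul_comm, ← add_smul, ← Nat.cast_add,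
    Finset.HasAntidiagonal.mem_antidiagonal.1 hij]

theorem euler_C (Y : 𝔸) : euler (C Y) = 0 := by
  ext k
  rw [coeff_euler, coeff_C]
  rcases eq_or_ne k 0 with rfl | hk
  · simp
  · simp [hk]

theorem euler_one : euler (1 : PowerSeries 𝔸) = 0 := by
  simpa using euler_C (1 : 𝔸)

theorem euler_expSeries (B : 𝔸) : euler (expSeries B) = C B * X * expSeries B := by
  ext k
  rw [coeff_euler, coeff_expSeries, mul_assoc, coeff_C_mul]
  rcases k with _ | k
  · simp
  · rw [coeff_succ_X_mul, coeff_expSeries, pow_succ', mul_smul_comm, smul_smul]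
    congr 1
    rw [Nat.factorial_succ]
    push_cast
    have : (k : ℂ) + 1 ≠ 0 := by exact_mod_cast k.succ_ne_zero
    field_simp

theorem X_mul_comm {R : Type*} [Semiring R] (φ : PowerSeries R) : X * φ = φ * X := (PowerSeries.commute_X φ).eq.symm

theorem C_mul_expSeries (B : 𝔸) : C B * expSeries B = expSeries B * C B := by
  ext k
  rw [coeff_C_mul, coeff_mul_C, coeff_expSeries, mul_smul_comm, smul_mul_assoc, ← pow_succ,
    ← pow_succ']

theorem euler_expSeries' (B : 𝔸) : euler (expSeries B) = expSeries B * (C B * X) := by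
  rw [euler_expSeries, mul_assoc, X_mul_comm, ← mul_assoc, C_mul_expSeries, mul_assoc]

/-- In characteristic zero the kernel of the Euler derivation consists of the constants. This
replaces uniqueness for differential equations. -/
theorem eq_one_of_euler_eq_zero {φ : PowerSeries 𝔸} (h : euler φ = 0) (h0 : coeff 0 φ = 1) :
    φ = 1 := by
  ext k
  rcases eq_or_ne k 0 with rfl | hk
  · simpa using h0
  · have h1 := congrArg (coeff k) h
    rw [coeff_euler, map_zero, smul_eq_zero] at h1
    rw [h1.resolve_left (by exact_mod_cast hk), coeff_one, if_neg hk]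

theorem expSeries_neg_mul (B : 𝔸) : expSeries (-B) * expSeries B = 1 := by
  refine eq_one_of_euler_eq_zero ?_ ?_
  · rw [euler_mul, euler_expSeries', euler_expSeries]
    simp [mul_assoc]
  · simp [coeff_mul, coeff_expSeries]

theorem expSeries_mul_neg (B : 𝔸) : expSeries B * expSeries (-B) = 1 := by
  simpa using expSeries_neg_mul (-B)

/-- The formal product of the exponentials of the members of a list. -/
noncomputable def expProd (bs : List 𝔸) : PowerSeries 𝔸 := (bs.map expSeries).prod

/-- The inverse of `expProd`. -/
noncomputable def expProdInv : List 𝔸 → PowerSeries 𝔸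
  | [] => 1
  | B :: bs => expProdInv bs * expSeries (-B)

theorem expProd_cons (B : 𝔸) (bs : List 𝔸) : expProd (B :: bs) = expSeries B * expProd bs := by
  simp [expProd]

theorem expProd_mul_expProdInv (bs : List 𝔸) : expProd bs * expProdInv bs = 1 := by
  induction bs with
  | nil => simp [expProd, expProdInv]
  | cons B bs ih =>
    rw [expProd_cons, expProdInv, mul_assoc, ← mul_assoc (expProd bs), ih, one_mul,
      expSeries_mul_neg]

/-- The formal conjugation of `Y` by a product of exponentials. -/
noncomputable def conjSeries (bs : List 𝔸) (Y : 𝔸) : PowerSeries 𝔸 :=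
  expProdInv bs * C Y * expProd bs

/-- The logarithmic Euler derivative of a product of exponentials. -/
noncomputable def logEuler : List 𝔸 → PowerSeries 𝔸
  | [] => 0
  | B :: bs => conjSeries bs B * X + logEuler bs

/-- The product rule drops a factor `B X` in front of the tail `P`; moving it to the far right turns
it into `P⁻¹ B P X`. -/
theorem euler_expProd (bs : List 𝔸) : euler (expProd bs) = expProd bs * logEuler bs := by
  induction bs with
  | nil => simp [expProd, logEuler, euler_one]
  | cons B bs ih =>
    have h : expProd bs * (conjSeries bs B * X) = C B * X * expProd bs := by
      rw [conjSeries, ← mul_assoc, ← mul_assoc, ← mul_assoc, expProd_mul_expProdInv, one_mul,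
        mul_assoc, mul_assoc, X_mul_comm]
    rw [expProd_cons, euler_mul, ih, logEuler, mul_add, mul_assoc (expSeries B) (expProd bs), h,
      euler_expSeries']
    simp only [mul_assoc]

/-- The conjugate `φ` satisfies `X φ' = [φ, B] X`, so its coefficients obey `(k+1) φ_{k+1} = [φ_k,
B]`. -/
theorem coeff_exp_conj (B Y : 𝔸) (k : ℕ) :
    coeff k (expSeries (-B) * C Y * expSeries B)
      = ((k.factorial : ℂ)⁻¹) • (fun Z => ⁅Z, B⁆)^[k] Y := by
  induction k with
  | zero => simp [coeff_mul, coeff_expSeries]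
  | succ k ih =>
    set φ := expSeries (-B) * C Y * expSeries B with hφ
    have h : euler φ = φ * C B * X - C B * φ * X := by
      rw [hφ, euler_mul, euler_mul, euler_C, euler_expSeries, euler_expSeries' B, mul_zero,
        add_zero, mul_assoc (C (-B)) X, X_mul_comm, mul_assoc _ (C B) X]
      simp only [mul_assoc, X_mul_comm, map_neg, neg_mul]
      abel
    have h1 := congrArg (coeff (k + 1)) h
    rw [coeff_euler, map_sub, coeff_succ_mul_X, coeff_succ_mul_X, coeff_mul_C, coeff_C_mul,
      ← Ring.lie_def, ih] at h1
    rw [Function.iterate_succ_apply', Nat.factorial_succ]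
    have h2 : ((k + 1 : ℕ) : ℂ) ≠ 0 := by exact_mod_cast k.succ_ne_zero
    rw [Nat.cast_mul, mul_inv, mul_smul, eq_inv_smul_iff₀ h2, h1]
    simp [Ring.lie_def, smul_sub]

theorem coeff_mul_mul_eq_sum {R : Type*} [Semiring R] (A Φ D : PowerSeries R) (k : ℕ) :
    coeff k (A * Φ * D) = ∑ ij ∈ Finset.HasAntidiagonal.antidiagonal k,
      coeff ij.1 (A * C (coeff ij.2 Φ) * D) := by
  simp only [coeff_mul _ _ D, coeff_mul _ A Φ, coeff_mul_C, Finset.sum_mul]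
  rw [Finset.sum_sigma', Finset.sum_sigma']
  refine Finset.sum_bij'
    (fun x _ => ⟨(x.2.1 + x.1.2, x.2.2), (x.2.1, x.1.2)⟩)
    (fun x _ => ⟨(x.2.1 + x.1.2, x.2.2), (x.2.1, x.1.2)⟩) ?_ ?_ ?_ ?_ ?_
  · rintro ⟨⟨a, b⟩, c, d⟩ h
    rw [Finset.mem_sigma, Finset.HasAntidiagonal.mem_antidiagonal,
      Finset.HasAntidiagonal.mem_antidiagonal] at h ⊢
    obtain ⟨h1, h2⟩ := h
    dsimp only at h1 h2 ⊢
    exact ⟨by omega, rfl⟩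
  · rintro ⟨⟨a, b⟩, c, d⟩ h
    rw [Finset.mem_sigma, Finset.HasAntidiagonal.mem_antidiagonal,
      Finset.HasAntidiagonal.mem_antidiagonal] at h ⊢
    obtain ⟨h1, h2⟩ := h
    dsimp only at h1 h2 ⊢
    exact ⟨by omega, rfl⟩
  · rintro ⟨⟨a, b⟩, c, d⟩ h
    simp only [Finset.mem_sigma, Finset.HasAntidiagonal.mem_antidiagonal] at h
    obtain ⟨h1, h2⟩ := h
    subst h2; rfl
  · rintro ⟨⟨a, b⟩, c, d⟩ h
    simp only [Finset.mem_sigma, Finset.HasAntidiagonal.mem_antidiagonal] at h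
    obtain ⟨h1, h2⟩ := h
    subst h2; rfl
  · rintro ⟨⟨a, b⟩, c, d⟩ h
    rfl

/-- The head conjugates first and produces iterated brackets with `B`; the tail then conjugates each
resulting coefficient separately. This is the recursion behind the commutator bound. -/
theorem coeff_conjSeries_cons (B Y : 𝔸) (bs : List 𝔸) (k : ℕ) :
    coeff k (conjSeries (B :: bs) Y) = ∑ ij ∈ Finset.HasAntidiagonal.antidiagonal k,
      coeff ij.1 (conjSeries bs (((ij.2.factorial : ℂ)⁻¹) • (fun Z => ⁅Z, B⁆)^[ij.2] Y)) := by
  have h : conjSeries (B :: bs) Y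
      = expProdInv bs * (expSeries (-B) * C Y * expSeries B) * expProd bs := by
    simp only [conjSeries, expProd_cons, expProdInv, mul_assoc]
  rw [h, coeff_mul_mul_eq_sum]
  simp only [coeff_exp_conj, conjSeries]

/-- The sum of the norms of the commutators `[[[Y, B₁], B₂], …, B_k]` with the `B_i` in a list. -/
noncomputable def commSum {R : Type*} [NormedRing R] : ℕ → List R → R → ℝ
  | 0, _, Y => ‖Y‖
  | k + 1, bs, Y => (bs.map fun B => commSum k bs ⁅Y, B⁆).sum

theorem commSum_nonneg {R : Type*} [NormedRing R] (k : ℕ) (bs : List R) (Y : R) : 0 ≤ commSum k bs Y := by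
  induction k generalizing Y with
  | zero => exact norm_nonneg _
  | succ k ih =>
    refine List.sum_nonneg fun x hx => ?_
    obtain ⟨B, -, rfl⟩ := List.mem_map.1 hx
    exact ih _

theorem commSum_smul (k : ℕ) (bs : List 𝔸) (c : ℂ) (Y : 𝔸) :
    commSum k bs (c • Y) = ‖c‖ * commSum k bs Y := by
  induction k generalizing Y with
  | zero => exact norm_smul _ _
  | succ k ih =>
    have h : ∀ B : 𝔸, ⁅c • Y, B⁆ = c • ⁅Y, B⁆ := fun B => by simp [Ring.lie_def, smul_sub]
    simp only [commSum, h, ih, List.sum_map_mul_left]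

theorem commSum_le_cons {R : Type*} [NormedRing R] (k : ℕ) (B : R) (bs : List R) (Y : R) :
    commSum k bs Y ≤ commSum k (B :: bs) Y := by
  induction k generalizing Y with
  | zero => exact le_rfl
  | succ k ih =>
    rw [commSum, commSum, List.map_cons, List.sum_cons]
    exact (List.sum_le_sum fun A _ => ih ⁅Y, A⁆).trans
      (le_add_of_nonneg_left (commSum_nonneg _ _ _))

/-- The words consisting of a power of `B` followed by letters of `bs` are among all words of length
`k` in `B :: bs`, and the other words contribute nonnegative terms. -/
theorem sum_commSum_iterate_le {R : Type*} [NormedRing R] (k : ℕ) (B : R) (bs : List R)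
    (Y : R) :
    ∑ ij ∈ Finset.HasAntidiagonal.antidiagonal k, commSum ij.1 bs ((fun Z => ⁅Z, B⁆)^[ij.2] Y)
      ≤ commSum k (B :: bs) Y := by
  induction k generalizing Y with
  | zero => simp [commSum]
  | succ k ih =>
    rw [Finset.Nat.sum_antidiagonal_succ']
    simp only [Function.iterate_succ_apply, Function.iterate_zero_apply]
    rw [commSum, commSum, List.map_cons, List.sum_cons, add_comm]
    exact add_le_add (ih _) (List.sum_le_sum fun A _ => commSum_le_cons _ _ _ _)

theorem norm_coeff_conjSeries_le (k : ℕ) (bs : List 𝔸) (Y : 𝔸) :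
    ‖coeff k (conjSeries bs Y)‖ ≤ commSum k bs Y := by
  induction bs generalizing k Y with
  | nil =>
    simp only [conjSeries, expProdInv, expProd, List.map_nil, List.prod_nil, one_mul, mul_one,
      coeff_C]
    split_ifs with h
    · subst h; exact le_rfl
    · simpa using commSum_nonneg k [] Y
  | cons B bs ih =>
    rw [coeff_conjSeries_cons]
    refine (norm_sum_le _ _).trans (le_trans ?_ (sum_commSum_iterate_le k B bs Y))
    refine Finset.sum_le_sum fun ij _ => (ih _ _).trans ?_
    rw [commSum_smul, norm_inv, Complex.norm_natCast]
    refine mul_le_of_le_one_left (commSum_nonneg _ _ _) (inv_le_one_of_one_le₀ ?_)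
    exact_mod_cast Nat.one_le_iff_ne_zero.2 (Nat.factorial_ne_zero _)

theorem norm_coeff_logEuler_le (k : ℕ) (bs : List 𝔸) :
    ‖coeff (k + 1) (logEuler bs)‖ ≤ (bs.map (commSum k bs)).sum := by
  induction bs with
  | nil => simp [logEuler]
  | cons B bs ih =>
    rw [logEuler, map_add, coeff_succ_mul_X, List.map_cons, List.sum_cons]
    refine (norm_add_le _ _).trans (add_le_add ?_ ?_)
    · exact (norm_coeff_conjSeries_le k bs B).trans (commSum_le_cons _ _ _ _)
    · exact ih.trans (List.sum_le_sum fun A _ => commSum_le_cons _ _ _ _)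

/-- The head is never a conjugating exponent, so it occurs only as the innermost entry. When the
head is a multiple of the whole Hamiltonian, subadditivity in that one slot then suffices. -/
theorem norm_coeff_logEuler_cons_le (k : ℕ) (B : 𝔸) (bs : List 𝔸) :
    ‖coeff (k + 1) (logEuler (B :: bs))‖ ≤ commSum k bs B + (bs.map (commSum k bs)).sum := by
  rw [logEuler, map_add, coeff_succ_mul_X]
  exact (norm_add_le _ _).trans
    (add_le_add (norm_coeff_conjSeries_le k bs B) (norm_coeff_logEuler_le k bs))

theorem coeff_zero_logEuler (bs : List 𝔸) : coeff 0 (logEuler bs) = 0 := by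
  induction bs with
  | nil => simp [logEuler]
  | cons B bs ih => rw [logEuler, map_add, ih, coeff_zero_mul_X, add_zero]

theorem coeff_zero_expProd (bs : List 𝔸) : coeff 0 (expProd bs) = 1 := by
  induction bs with
  | nil => simp [expProd]
  | cons B bs ih => rw [expProd_cons, coeff_mul]; simp [coeff_expSeries, ih]

/-- If the coefficients of a product of exponentials vanish in the degrees `1, …, p`, `p ≥ 1`, then
its coefficient of degree `p + 2` is that of the logarithmic derivative, up to the degree. -/
theorem coeff_expProd_of_coeff_eq_zero {p : ℕ} (hp : 1 ≤ p) {bs : List 𝔸}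
    (h : ∀ k, 1 ≤ k → k ≤ p → coeff k (expProd bs) = 0) :
    ((p + 2 : ℕ) : ℂ) • coeff (p + 2) (expProd bs) = coeff (p + 2) (logEuler bs) := by
  have key : ∀ k : ℕ, (k : ℂ) • coeff k (expProd bs) = ∑ ij ∈ Finset.HasAntidiagonal.antidiagonal k,
      coeff ij.1 (expProd bs) * coeff ij.2 (logEuler bs) := fun k => by
    rw [← coeff_mul, ← euler_expProd, coeff_euler]
  have hG1 : coeff 1 (logEuler bs) = 0 := by
    have := key 1
    rw [h 1 le_rfl hp, Finset.Nat.sum_antidiagonal_succ] at this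
    simpa [coeff_zero_expProd, coeff_zero_logEuler, ← coeff_zero_eq_constantCoeff_apply]
      using this.symm
  -- Degrees `1, …, p` vanish by hypothesis. In degrees `p + 1` and `p + 2` the partner is a
  -- coefficient of the logarithmic derivative of degree `1` or `0`, which is zero.
  rw [key, Finset.sum_eq_single (0, p + 2)]
  · rw [coeff_zero_expProd, one_mul]
  · rintro ⟨i, j⟩ hij hne
    have hij' : i + j = p + 2 := Finset.HasAntidiagonal.mem_antidiagonal.1 hij
    simp only
    rcases Nat.eq_zero_or_pos i with hi | hi
    · exact absurd (by ext <;> simp <;> omega) hne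
    · rcases Nat.lt_or_ge p i with hpi | hpi
      · have : j = 0 ∨ j = 1 := by omega
        rcases this with rfl | rfl
        · rw [coeff_zero_logEuler, mul_zero]
        · rw [hG1, mul_zero]
      · rw [h i hi hpi, zero_mul]
  · intro hn
    exact absurd (Finset.HasAntidiagonal.mem_antidiagonal.2 (by simp)) hn

theorem expProd_eq_one_of_logEuler_eq_zero {bs : List 𝔸} (h : logEuler bs = 0) :
    expProd bs = 1 :=
  eq_one_of_euler_eq_zero (by rw [euler_expProd, h, mul_zero]) (coeff_zero_expProd bs)

end Formal

/-! ### The multiplicative error as a product of exponentials. -/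

section ProductFormula

open PowerSeries Asymptotics

theorem isEntireSum_expProd {𝔸 : Type*} [NormedRing 𝔸] [NormedAlgebra ℂ 𝔸] [CompleteSpace 𝔸]
    (bs : List 𝔸) : IsEntireSum
      (fun t : ℝ => (bs.map fun B => NormedSpace.exp ((t : ℂ) • B)).prod) (expProd bs) := by
  induction bs with
  | nil => simpa [expProd] using isEntireSum_one
  | cons B bs ih =>
    simp only [List.map_cons, List.prod_cons, expProd_cons]
    exact (isEntireSum_exp B).mul ih

variable {N L : ℕ}

/-- The exponents of one stage of a product formula at time `1`. -/
noncomputable def stageExponents (H : Fin L → Op N) (s : ℝ × Bool) : List (Op N) :=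
  let bs := List.ofFn fun l => (-(Complex.I * (s.1 : ℂ))) • H l
  if s.2 then bs.reverse else bs

/-- The exponents of a product formula at time `1`. -/
noncomputable def exponents (F : List (ℝ × Bool)) (H : Fin L → Op N) : List (Op N) :=
  F.flatMap (stageExponents H)

theorem evol_mul_time (A : Op N) (a t : ℝ) :
    evol A (a * t) = NormedSpace.exp ((t : ℂ) • ((-(Complex.I * (a : ℂ))) • A)) := by
  rw [evol, smul_smul]
  congr 2
  push_cast
  ring

theorem isEntireSum_evol (A : Op N) (a : ℝ) :
    IsEntireSum (fun t => evol A (a * t)) (expSeries ((-(Complex.I * (a : ℂ))) • A)) := by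
  simp only [evol_mul_time]
  exact isEntireSum_exp _

theorem stage_eq_prod (H : Fin L → Op N) (t : ℝ) (s : ℝ × Bool) :
    stage H t s = ((stageExponents H s).map fun B => NormedSpace.exp ((t : ℂ) • B)).prod := by
  obtain ⟨a, b⟩ := s
  cases b <;>
  simp [stage, stageExponents, evol_mul_time, List.map_ofFn, List.map_reverse, Function.comp_def]

theorem prodFormula_eq_prod (F : List (ℝ × Bool)) (H : Fin L → Op N) (t : ℝ) :
    prodFormula F H t
      = ((exponents F H).map fun B => NormedSpace.exp ((t : ℂ) • B)).prod := by
  induction F with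
  | nil => simp [prodFormula, exponents]
  | cons s F ih =>
    simp only [prodFormula, exponents, List.map_cons, List.prod_cons, List.flatMap_cons,
      List.map_append, List.prod_append] at ih ⊢
    rw [ih, stage_eq_prod]

theorem isEntireSum_prodFormula (F : List (ℝ × Bool)) (H : Fin L → Op N) :
    IsEntireSum (prodFormula F H) (expProd (exponents F H)) := by
  have := isEntireSum_expProd (exponents F H)
  simpa only [← prodFormula_eq_prod] using this

theorem evol_neg_mul_evol (A : Op N) (t : ℝ) : evol A (-t) * evol A t = 1 := by
  rw [evol, evol, ← Matrix.exp_add_of_commute]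
  · simp
  · exact (Commute.refl A).smul_left _ |>.smul_right _

theorem evol_mul_evol_neg (A : Op N) (t : ℝ) : evol A t * evol A (-t) = 1 := by
  simpa using evol_neg_mul_evol A (-t)

/-- Reading `e^{iHt}` as one more leading factor makes `1 + ℳ` accessible to the formal calculus;
the `-1` in the head exponent is its reversed time. -/
theorem isEntireSum_multError_add_one (F : List (ℝ × Bool)) (H : Fin L → Op N) :
    IsEntireSum (fun t => evol (∑ l, H l) (-t) * prodFormula F H t)
      (expProd (((-(Complex.I * ((-1 : ℝ) : ℂ))) • ∑ l, H l) :: exponents F H)) := by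
  rw [expProd_cons]
  have h := isEntireSum_evol (∑ l, H l) (-1)
  simp only [neg_one_mul] at h
  exact h.mul (isEntireSum_prodFormula F H)

theorem isEntireSum_multError (F : List (ℝ × Bool)) (H : Fin L → Op N) :
    IsEntireSum (multError F H)
      (expProd (((-(Complex.I * ((-1 : ℝ) : ℂ))) • ∑ l, H l) :: exponents F H) - 1) :=
  (isEntireSum_multError_add_one F H).sub isEntireSum_one

theorem HasOrder.multError_isBigO {p : ℕ} {F : List (ℝ × Bool)} {H : Fin L → Op N}
    (h : HasOrder p F H) : multError F H =O[𝓝 0] fun t : ℝ => t ^ (p + 1) := by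
  have h1 := (isEntireSum_evol (∑ l, H l) (-1)).remainder_isBigO 0
  simp only [Finset.range_zero, Finset.sum_empty, sub_zero, neg_one_mul] at h1
  refine ((h1.mul h).congr_left fun t => ?_).congr_right fun t => ?_
  · rw [mul_sub, evol_neg_mul_evol, multError]
  · rw [pow_zero, one_mul]

theorem HasOrder.coeff_eq_zero {p : ℕ} {F : List (ℝ × Bool)} {H : Fin L → Op N}
    (h : HasOrder p F H) {k : ℕ} (h1 : 1 ≤ k) (hk : k ≤ p) :
    coeff k (expProd (((-(Complex.I * ((-1 : ℝ) : ℂ))) • ∑ l, H l) :: exponents F H)) = 0 := by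
  have := (isEntireSum_multError F H).coeff_eq_zero h.multError_isBigO (k := k) (by omega)
  rwa [map_sub, coeff_one, if_neg (by omega), sub_zero] at this

/-! ### The commutator bound -/

theorem sum_map_exponents (F : List (ℝ × Bool)) (H : Fin L → Op N) (g : Op N → ℝ)
    (hg : ∀ (c : ℂ) Y, g (c • Y) = ‖c‖ * g Y) :
    ((exponents F H).map g).sum = (F.map fun s => |s.1|).sum * ∑ l, g (H l) := by
  induction F with
  | nil => simp [exponents]
  | cons s F ih =>
    have h : ((stageExponents H s).map g).sum = |s.1| * ∑ l, g (H l) := by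
      obtain ⟨a, b⟩ := s
      cases b <;>
      simp [stageExponents, List.map_ofFn, List.map_reverse, List.sum_reverse,
        Function.comp_def, List.sum_ofFn, hg, Finset.mul_sum, -neg_smul]
    simp only [exponents, List.flatMap_cons, List.map_append, List.sum_append, List.map_cons,
      List.sum_cons, add_mul] at ih ⊢
    rw [ih, h]

/-- The sum of the norms of `[H_{l_1}, [H_{l_2}, …, [H_{l_k}, Y]]]` over all `l_1, …, l_k`. -/
noncomputable def adSum (H : Fin L → Op N) : ℕ → Op N → ℝ
  | 0, Y => ‖Y‖
  | k + 1, Y => ∑ l, adSum H k ⁅H l, Y⁆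

theorem adSum_smul (H : Fin L → Op N) (k : ℕ) (c : ℂ) (Y : Op N) :
    adSum H k (c • Y) = ‖c‖ * adSum H k Y := by
  induction k generalizing Y with
  | zero => exact norm_smul _ _
  | succ k ih =>
    have h : ∀ B : Op N, ⁅B, c • Y⁆ = c • ⁅B, Y⁆ := fun B => by simp [Ring.lie_def, smul_sub]
    simp only [adSum, h, ih, Finset.mul_sum]

/-- Each bracket with `-i a_s H_l` has weight `|a_s|`, so summing over the stages yields one factor
`∑ |a_s|` per bracket. Reversing a bracket only changes a sign. -/
theorem commSum_exponents (F : List (ℝ × Bool)) (H : Fin L → Op N) (k : ℕ) (Y : Op N) :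
    commSum k (exponents F H) Y = (F.map fun s => |s.1|).sum ^ k * adSum H k Y := by
  induction k generalizing Y with
  | zero => simp [commSum, adSum]
  | succ k ih =>
    rw [commSum, sum_map_exponents F H]
    · have h : ∀ l, adSum H k ⁅Y, H l⁆ = adSum H k ⁅H l, Y⁆ := fun l => by
        have h2 : ⁅Y, H l⁆ = (-1 : ℂ) • ⁅H l, Y⁆ := by simp [Ring.lie_def]
        rw [h2, adSum_smul]; simp
      simp only [ih, h, adSum, ← Finset.mul_sum]
      ring
    · intro c B
      rw [show ⁅Y, c • B⁆ = c • ⁅Y, B⁆ by simp [Ring.lie_def, smul_sub], commSum_smul]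

/-- `[A 0, [A 1, …, [A (k-1), Y]]]`. -/
def adTuple : (k : ℕ) → (Fin k → Op N) → Op N → Op N
  | 0, _, Y => Y
  | k + 1, A, Y => ⁅A 0, adTuple k (fun i => A i.succ) Y⁆

/-- The recursion in `adSum` peels off the innermost bracket, the one in `nestedComm` the outermost;
this reconciles them. -/
theorem adTuple_succ_last (k : ℕ) (A : Fin (k + 1) → Op N) (Y : Op N) :
    adTuple (k + 1) A Y = adTuple k (fun i => A i.castSucc) ⁅A (Fin.last k), Y⁆ := by
  induction k with
  | zero => rfl
  | succ k ih =>
    rw [adTuple, ih, adTuple]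
    rfl

theorem nestedComm_eq_adTuple (k : ℕ) (A : Fin (k + 1) → Op N) :
    nestedComm k A = adTuple k (fun i => A i.castSucc) (A (Fin.last k)) := by
  induction k with
  | zero => rfl
  | succ k ih =>
    rw [nestedComm, ih, adTuple]
    rfl

theorem sum_fin_succ_last {k L : ℕ} (g : (Fin (k + 1) → Fin L) → ℝ) :
    ∑ w, g w = ∑ l, ∑ w : Fin k → Fin L, g (Fin.snoc (α := fun _ => Fin L) w l) := by
  rw [← Fintype.sum_prod_type']
  exact (Fintype.sum_equiv (Fin.snocEquiv fun _ => Fin L) _ _ fun _ => rfl).symm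

theorem adSum_eq_sum (H : Fin L → Op N) (k : ℕ) (Y : Op N) :
    adSum H k Y = ∑ w : Fin k → Fin L, ‖adTuple k (fun i => H (w i)) Y‖ := by
  induction k generalizing Y with
  | zero => simp [adSum, adTuple]
  | succ k ih =>
    rw [sum_fin_succ_last]
    simp only [adTuple_succ_last, Fin.snoc_castSucc, Fin.snoc_last, adSum, ih]

theorem sum_adSum (H : Fin L → Op N) (k : ℕ) : ∑ l, adSum H k (H l) = alpha k H := by
  rw [alpha, sum_fin_succ_last]
  simp only [nestedComm_eq_adTuple, Fin.snoc_castSucc, Fin.snoc_last, adSum_eq_sum]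

theorem adSum_sum_le (H : Fin L → Op N) (k : ℕ) {ι : Type*} (s : Finset ι) (Y : ι → Op N) :
    adSum H k (∑ i ∈ s, Y i) ≤ ∑ i ∈ s, adSum H k (Y i) := by
  induction k generalizing Y with
  | zero => exact norm_sum_le _ _
  | succ k ih =>
    simp only [adSum]
    rw [Finset.sum_comm]
    refine Finset.sum_le_sum fun l _ => ?_
    have h : ⁅H l, ∑ i ∈ s, Y i⁆ = ∑ i ∈ s, ⁅H l, Y i⁆ := by
      simp [Ring.lie_def, Finset.mul_sum, Finset.sum_mul]
    rw [h]
    exact ih _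

theorem alpha_nonneg (H : Fin L → Op N) (k : ℕ) : 0 ≤ alpha k H :=
  Finset.sum_nonneg fun _ _ => norm_nonneg _

theorem norm_coeff_logEuler_multError_le (F : List (ℝ × Bool)) (H : Fin L → Op N) (k : ℕ) :
    ‖coeff (k + 1)
      (logEuler (((-(Complex.I * ((-1 : ℝ) : ℂ))) • ∑ l, H l) :: exponents F H))‖
      ≤ ((F.map fun s => |s.1|).sum ^ k + (F.map fun s => |s.1|).sum ^ (k + 1)) * alpha k H := by
  have hA : 0 ≤ (F.map fun s => |s.1|).sum := List.sum_nonneg fun x hx => by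
    obtain ⟨s, -, rfl⟩ := List.mem_map.1 hx
    exact abs_nonneg _
  refine (norm_coeff_logEuler_cons_le k _ _).trans ?_
  rw [sum_map_exponents F H (commSum k (exponents F H)) (commSum_smul _ _), commSum_smul]
  simp only [commSum_exponents]
  rw [← Finset.mul_sum, sum_adSum, add_mul, pow_succ']
  refine add_le_add ?_ (by rw [mul_assoc])
  rw [show ‖-(Complex.I * ((-1 : ℝ) : ℂ))‖ = 1 by simp, one_mul, ← sum_adSum]
  gcongr
  exact adSum_sum_le H k _ _

/-! ### Vanishing nested commutators -/

open scoped ComplexOrder in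
-- Put `Y = [A, X]`. Since `A` is Hermitian and commutes with `Y`, it commutes with `Y†`, and
-- cyclicity of the trace gives `tr(Y†Y) = tr(Y†AX) - tr(Y†XA) = 0`.
theorem lie_eq_zero_of_lie_lie_eq_zero {A X : Op N} (hA : A.IsHermitian) (h : ⁅A, ⁅A, X⁆⁆ = 0) :
    ⁅A, X⁆ = 0 := by
  have h1 : A * ⁅A, X⁆ = ⁅A, X⁆ * A := sub_eq_zero.1 h
  have h2 : (⁅A, X⁆)ᴴ * A = A * (⁅A, X⁆)ᴴ := by
    have := congrArg Matrix.conjTranspose h1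
    rwa [Matrix.conjTranspose_mul, Matrix.conjTranspose_mul, hA.eq] at this
  rw [← Matrix.trace_conjTranspose_mul_self_eq_zero_iff]
  nth_rewrite 2 [Ring.lie_def]
  rw [mul_sub, Matrix.trace_sub, ← mul_assoc, h2, ← mul_assoc, Matrix.trace_mul_comm _ A,
    ← mul_assoc, sub_self]

theorem lie_eq_zero_of_iterate_lie_eq_zero {A X : Op N} (hA : A.IsHermitian) (n : ℕ)
    (h : (fun Y => ⁅A, Y⁆)^[n + 1] X = 0) : ⁅A, X⁆ = 0 := by
  induction n with
  | zero => exact h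
  | succ n ih =>
    rw [Function.iterate_succ_apply', Function.iterate_succ_apply'] at h
    apply ih
    rw [Function.iterate_succ_apply']
    exact lie_eq_zero_of_lie_lie_eq_zero hA h

theorem lie_eq_zero_of_alpha_eq_zero {H : Fin L → Op N} (hH : ∀ l, (H l).IsHermitian) {k : ℕ}
    (h : alpha (k + 1) H = 0) (i j : Fin L) : ⁅H i, H j⁆ = 0 := by
  refine lie_eq_zero_of_iterate_lie_eq_zero (hH i) k ?_
  -- The index word `(i, …, i, j)` picks out the iterated commutator of `H i` applied to `H j`.
  have h1 := (Finset.sum_eq_zero_iff_of_nonneg fun _ _ => norm_nonneg _).1 h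
    (Fin.snoc (α := fun _ => Fin L) (fun _ => i) j) (Finset.mem_univ _)
  simp only [nestedComm_eq_adTuple, Fin.snoc_castSucc, Fin.snoc_last, norm_eq_zero] at h1
  rw [← h1]
  have h2 : ∀ n : ℕ, (fun Y => ⁅H i, Y⁆)^[n] (H j) = adTuple n (fun _ => H i) (H j) := by
    intro n
    induction n with
    | zero => rfl
    | succ n ih => rw [Function.iterate_succ_apply', ih, adTuple]
  exact h2 _

theorem alpha_succ_eq_zero {H : Fin L → Op N} (h : ∀ i j, ⁅H i, H j⁆ = 0) (k : ℕ) :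
    alpha (k + 1) H = 0 := by
  have h0 : ∀ n, adSum H n (0 : Op N) = 0 := fun n => by
    simpa using adSum_smul H n 0 (0 : Op N)
  rw [← sum_adSum]
  simp [adSum, h, h0]

/-- If the nested commutators of order `p + 2` of Hermitian operators vanish, then a product
formula of order `p ≥ 1` is exact. -/
theorem multError_eq_zero_of_alpha_eq_zero {p : ℕ} (hp : 1 ≤ p) {F : List (ℝ × Bool)}
    {H : Fin L → Op N} (hH : ∀ l, (H l).IsHermitian) (ho : HasOrder p F H)
    (h : alpha (p + 1) H = 0) (t : ℝ) : multError F H t = 0 := by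
  have hc := lie_eq_zero_of_alpha_eq_zero hH h
  set bs := ((-(Complex.I * ((-1 : ℝ) : ℂ))) • ∑ l, H l) :: exponents F H with hbs
  have h1 : coeff 1 (logEuler bs) = 0 := by
    have h2 := congrArg (coeff 1) (euler_expProd bs)
    rw [coeff_euler, ho.coeff_eq_zero le_rfl hp, smul_zero, coeff_mul,
      Finset.Nat.sum_antidiagonal_succ] at h2
    simpa [coeff_zero_expProd, coeff_zero_logEuler, ← coeff_zero_eq_constantCoeff_apply]
      using h2.symm
  have h2 : logEuler bs = 0 := by
    ext k : 1
    rw [map_zero]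
    rcases k with _ | _ | k
    · exact coeff_zero_logEuler bs
    · exact h1
    · have := norm_coeff_logEuler_multError_le F H (k + 1)
      rw [alpha_succ_eq_zero hc, mul_zero] at this
      exact norm_le_zero_iff.1 this
  have h3 := (isEntireSum_multError F H t).2
  rw [h3, ← hbs, expProd_eq_one_of_logEuler_eq_zero h2, sub_self]
  simp

/-- The leading coefficient of the multiplicative error, and the commutator bound on the
remainder. -/
theorem exists_multError_bound {p : ℕ} (hp : 1 ≤ p) (F : List (ℝ × Bool)) :
    ∃ C : ℝ, 0 ≤ C ∧ ∀ (N L : ℕ) (H : Fin L → Op N), (∀ l, (H l).IsHermitian) → HasOrder p F H →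
      ∃ (M : Op N) (t₀ : ℝ), 0 < t₀ ∧ ∀ t : ℝ, 0 < t → t ≤ t₀ →
        ‖multError F H t - (t : ℂ) ^ (p + 1) • M‖ ≤ C * alpha (p + 1) H * t ^ (p + 2) := by
  set A := (F.map fun s => |s.1|).sum with hA
  have hA0 : 0 ≤ A := List.sum_nonneg fun x hx => by
    obtain ⟨s, -, rfl⟩ := List.mem_map.1 hx
    exact abs_nonneg _
  -- The two powers bound the coefficient of degree `p + 2`; the `1` pays for all higher degrees.
  refine ⟨A ^ (p + 1) + A ^ (p + 2) + 1, by positivity, fun N L H hH ho => ?_⟩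
  rcases (alpha_nonneg H (p + 1)).eq_or_lt with h0 | hpos
  · refine ⟨0, 1, one_pos, fun t _ _ => ?_⟩
    rw [multError_eq_zero_of_alpha_eq_zero hp hH ho h0.symm, ← h0]
    simp
  set bs := ((-(Complex.I * ((-1 : ℝ) : ℂ))) • ∑ l, H l) :: exponents F H with hbs
  have hE := isEntireSum_multError F H
  rw [← hbs] at hE
  have hc : ∀ k < p + 1, coeff k (expProd bs - 1) = 0 := fun k hk =>
    hE.coeff_eq_zero ho.multError_isBigO hk
  have hM : ‖coeff (p + 2) (expProd bs - 1)‖ ≤ (A ^ (p + 1) + A ^ (p + 2)) * alpha (p + 1) H := by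
    have h1 := coeff_expProd_of_coeff_eq_zero hp (bs := bs)
      fun k h1 hk => ho.coeff_eq_zero h1 hk
    have h2 := norm_coeff_logEuler_multError_le F H (p + 1)
    rw [← hbs, ← h1, norm_smul, Complex.norm_natCast] at h2
    rw [map_sub, coeff_one, if_neg (by omega), sub_zero]
    refine le_trans (le_mul_of_one_le_left (norm_nonneg _) ?_) h2
    exact_mod_cast (by omega : 1 ≤ p + 2)
  obtain ⟨K, hK0, hK⟩ := hE.remainder (p + 3)
  -- This `t₀` makes `K t ≤ alpha (p + 1) H`. It is positive only because `alpha` is, hence the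
  -- separate case above.
  refine ⟨coeff (p + 1) (expProd bs - 1), min 1 (alpha (p + 1) H / (K + 1)), by positivity,
    fun t ht0 ht => ?_⟩
  have ht1 : t ≤ 1 := ht.trans (min_le_left _ _)
  have ht2 : t ≤ alpha (p + 1) H / (K + 1) := ht.trans (min_le_right _ _)
  have ht3 : K * t ≤ alpha (p + 1) H := by
    have := (le_div_iff₀ (by positivity)).1 ht2
    nlinarith
  have h1 := hK t (by rwa [abs_of_pos ht0])
  rw [abs_of_pos ht0, Finset.sum_range_succ, Finset.sum_range_succ,
    Finset.sum_eq_zero fun k hk => by rw [hc k (Finset.mem_range.1 hk), smul_zero], zero_add] at h1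
  calc ‖multError F H t - (t : ℂ) ^ (p + 1) • coeff (p + 1) (expProd bs - 1)‖
      = ‖(multError F H t - ((t : ℂ) ^ (p + 1) • coeff (p + 1) (expProd bs - 1)
          + (t : ℂ) ^ (p + 2) • coeff (p + 2) (expProd bs - 1)))
          + (t : ℂ) ^ (p + 2) • coeff (p + 2) (expProd bs - 1)‖ := by congr 1; abel
    _ ≤ K * t ^ (p + 3)
          + t ^ (p + 2) * ((A ^ (p + 1) + A ^ (p + 2)) * alpha (p + 1) H) := by
        refine (norm_add_le _ _).trans (add_le_add h1 ?_)
        rw [norm_smul, norm_pow, Complex.norm_real, Real.norm_eq_abs, abs_of_pos ht0]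
        gcongr
    _ = t ^ (p + 2) * (K * t + (A ^ (p + 1) + A ^ (p + 2)) * alpha (p + 1) H) := by ring
    _ ≤ t ^ (p + 2) * (alpha (p + 1) H
          + (A ^ (p + 1) + A ^ (p + 2)) * alpha (p + 1) H) := by gcongr
    _ = _ := by ring

end ProductFormula

/-! ### Orders of the standard product formulas. -/

section Suzuki

open PowerSeries Asymptotics

variable {N L : ℕ}

theorem isEntireSum_sub_evol (F : List (ℝ × Bool)) (H : Fin L → Op N) :
    IsEntireSum (fun t => prodFormula F H t - evol (∑ l, H l) t)
      (expProd (exponents F H) - expSeries ((-(Complex.I * ((1 : ℝ) : ℂ))) • ∑ l, H l)) := by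
  have h := isEntireSum_evol (∑ l, H l) 1
  simp only [one_mul] at h
  exact (isEntireSum_prodFormula F H).sub h

theorem coeff_one_expProd {𝔸 : Type*} [NormedRing 𝔸] [NormedAlgebra ℂ 𝔸] (bs : List 𝔸) :
    coeff 1 (expProd bs) = bs.sum := by
  induction bs with
  | nil => simp [expProd, coeff_one]
  | cons B bs ih =>
    rw [expProd_cons, coeff_mul, Finset.Nat.sum_antidiagonal_succ]
    simp [coeff_expSeries, ih, coeff_zero_expProd, add_comm]

theorem sum_exponents (F : List (ℝ × Bool)) (H : Fin L → Op N) :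
    (exponents F H).sum = (-(Complex.I * (((F.map Prod.fst).sum : ℝ) : ℂ))) • ∑ l, H l := by
  induction F with
  | nil => simp [exponents]
  | cons s F ih =>
    have h : (stageExponents H s).sum = (-(Complex.I * (s.1 : ℂ))) • ∑ l, H l := by
      obtain ⟨a, b⟩ := s
      cases b <;> simp [stageExponents, List.sum_reverse, List.sum_ofFn, Finset.smul_sum, -neg_smul]
    simp only [exponents, List.flatMap_cons, List.sum_append, List.map_cons, List.sum_cons] at ih ⊢
    rw [ih, h, ← add_smul]
    congr 1
    push_cast
    ring

theorem hasOrder_one_of_sum_eq_one {F : List (ℝ × Bool)} (hF : (F.map Prod.fst).sum = 1)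
    (H : Fin L → Op N) : HasOrder 1 F H := by
  refine (isEntireSum_sub_evol F H).isBigO_of_coeff_eq_zero fun k hk => ?_
  interval_cases k
  · rw [map_sub, coeff_zero_expProd, coeff_expSeries]
    simp
  · rw [map_sub, coeff_one_expProd, coeff_expSeries, sum_exponents, hF]
    simp

/-- `G(t) = e^{-i x t A} + t^n E + O(t^{n+1})`. -/
def HasLeadingError (A : Op N) (n : ℕ) (G : ℝ → Op N) (x : ℝ) (E : Op N) : Prop :=
  (fun t : ℝ => G t - evol A (x * t) - (t : ℂ) ^ n • E) =O[𝓝 0] fun t : ℝ => t ^ (n + 1)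

theorem evol_sub_one_isBigO (A : Op N) (x : ℝ) :
    (fun t : ℝ => evol A (x * t) - 1) =O[𝓝 0] fun t : ℝ => t ^ 1 := by
  simpa [coeff_expSeries] using (isEntireSum_evol A x).remainder_isBigO 1

theorem pow_smul_isBigO (n : ℕ) (E : Op N) :
    (fun t : ℝ => (t : ℂ) ^ n • E) =O[𝓝 0] fun t : ℝ => t ^ n :=
  IsBigO.of_bound ‖E‖ (Filter.Eventually.of_forall fun t => by
    rw [norm_smul, norm_pow, norm_pow, Complex.norm_real, mul_comm])

theorem pow_isBigO_pow {m n : ℕ} (h : m ≤ n) :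
    (fun t : ℝ => t ^ n) =O[𝓝 0] fun t : ℝ => t ^ m :=
  IsBigO.of_bound 1 (by
    filter_upwards [Metric.closedBall_mem_nhds (0 : ℝ) one_pos] with t ht
    rw [norm_pow, norm_pow, one_mul]
    exact pow_le_pow_of_le_one (norm_nonneg _) (by simpa using ht) h)

theorem isBigO_one_of_sub_one {G : ℝ → Op N}
    (h : (fun t : ℝ => G t - 1) =O[𝓝 0] fun t : ℝ => t ^ 1) :
    G =O[𝓝 0] fun t : ℝ => t ^ 0 := by
  have h1 : (fun _ : ℝ => (1 : Op N)) =O[𝓝 0] fun t : ℝ => t ^ 0 := by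
    simpa using isBigO_const_const (1 : Op N) (one_ne_zero (α := ℝ)) (𝓝 (0 : ℝ))
  refine ((h.trans (pow_isBigO_pow zero_le_one)).add h1).congr_left fun t => ?_
  rw [sub_add_cancel]

theorem HasLeadingError.sub_one_isBigO {A : Op N} {n : ℕ} (hn : 1 ≤ n) {G : ℝ → Op N} {x : ℝ}
    {E : Op N} (h : HasLeadingError A n G x E) :
    (fun t : ℝ => G t - 1) =O[𝓝 0] fun t : ℝ => t ^ 1 := by
  refine (((h.trans (pow_isBigO_pow (by omega))).add (evol_sub_one_isBigO A x)).add
    ((pow_smul_isBigO n E).trans (pow_isBigO_pow hn))).congr_left fun t => ?_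
  abel

theorem evol_add (A : Op N) (s t : ℝ) : evol A (s + t) = evol A s * evol A t := by
  rw [evol, evol, evol, ← Matrix.exp_add_of_commute, ← add_smul]
  · congr 2
    push_cast
    ring
  · exact (Commute.refl A).smul_left _ |>.smul_right _

/-- Both factors are `1 + O(t)`, so multiplying an error `t^n E` by either changes it only by
`O(t^(n+1))`. The error splits into four such products. -/
theorem HasLeadingError.mul {A : Op N} {n : ℕ} (hn : 1 ≤ n) {G G' : ℝ → Op N} {x x' : ℝ}
    {E E' : Op N} (h : HasLeadingError A n G x E) (h' : HasLeadingError A n G' x' E') :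
    HasLeadingError A n (fun t => G t * G' t) (x + x') (E + E') := by
  have hG' := h'.sub_one_isBigO hn
  have h1 := IsBigO.mul h (isBigO_one_of_sub_one hG')
  have h2 := (pow_smul_isBigO n E).mul hG'
  have h3 := (isBigO_one_of_sub_one (evol_sub_one_isBigO A x)).mul h'
  have h4 := (evol_sub_one_isBigO A x).mul (pow_smul_isBigO n E')
  simp only [← pow_add, zero_add, add_zero, add_comm 1 n] at h1 h2 h3 h4
  refine (((h1.add h2).add h3).add h4).congr_left fun t => ?_
  rw [add_mul x, evol_add, smul_add]
  generalize (t : ℂ) ^ n • E = Y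
  generalize (t : ℂ) ^ n • E' = Y'
  noncomm_ring

theorem HasLeadingError.comp_mul {A : Op N} {n : ℕ} {G : ℝ → Op N} {x : ℝ}
    {E : Op N} (h : HasLeadingError A n G x E) (c : ℝ) :
    HasLeadingError A n (fun t => G (c * t)) (x * c) ((c : ℂ) ^ n • E) := by
  have hc : Filter.Tendsto (fun t : ℝ => c * t) (𝓝 0) (𝓝 0) := by
    have : Continuous fun t : ℝ => c * t := by fun_prop
    simpa using this.tendsto 0
  refine ((h.comp_tendsto hc).congr_left fun t => ?_).trans
    (IsBigO.of_bound (|c| ^ (n + 1)) (Filter.Eventually.of_forall fun t => ?_))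
  · simp only [Function.comp_apply, Complex.ofReal_mul, mul_pow, smul_smul, mul_assoc]
    rw [mul_comm ((t : ℂ) ^ n)]
  · simp [mul_pow]

theorem HasOrder.hasLeadingError {p : ℕ} {F : List (ℝ × Bool)} {H : Fin L → Op N}
    (h : HasOrder p F H) :
    ∃ E, HasLeadingError (∑ l, H l) (p + 1) (prodFormula F H) 1 E := by
  have hE := isEntireSum_sub_evol F H
  refine ⟨coeff (p + 1) (expProd (exponents F H)
    - expSeries ((-(Complex.I * ((1 : ℝ) : ℂ))) • ∑ l, H l)),
    (hE.remainder_isBigO (p + 1 + 1)).congr_left fun t => ?_⟩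
  rw [Finset.sum_range_succ, Finset.sum_eq_zero (s := Finset.range (p + 1)), zero_add,
    one_mul]
  intro k hk
  rw [hE.coeff_eq_zero h (Finset.mem_range.1 hk), smul_zero]

theorem HasLeadingError.hasOrder {n : ℕ} {F : List (ℝ × Bool)} {H : Fin L → Op N}
    (h : HasLeadingError (∑ l, H l) n (prodFormula F H) 1 0) : HasOrder n F H :=
  h.congr_left fun t => by rw [smul_zero, sub_zero, one_mul]

theorem prodFormula_append (F G : List (ℝ × Bool)) (H : Fin L → Op N) (t : ℝ) :
    prodFormula (F ++ G) H t = prodFormula F H t * prodFormula G H t := by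
  simp [prodFormula]

theorem prodFormula_scale (c : ℝ) (F : List (ℝ × Bool)) (H : Fin L → Op N) (t : ℝ) :
    prodFormula (scale c F) H t = prodFormula F H (c * t) := by
  rw [prodFormula, scale, List.map_map, prodFormula]
  congr 2
  ext1 s
  simp only [Function.comp_apply, stage]
  rw [show c * s.1 * t = s.1 * (c * t) by ring]

/-- The stages in reversed order, each of them reversed. -/
def revStages (F : List (ℝ × Bool)) : List (ℝ × Bool) := (F.map fun s => (s.1, !s.2)).reverse

theorem prod_reverse_mul_prod_eq_one {R : Type*} [Monoid R] {ι : Type*} (l : List ι) (f g : ι → R)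
    (h : ∀ i ∈ l, f i * g i = 1) : (l.map f).reverse.prod * (l.map g).prod = 1 := by
  induction l with
  | nil => simp
  | cons i l ih =>
    rw [List.map_cons, List.map_cons, List.reverse_cons, List.prod_append, List.prod_singleton,
      List.prod_cons, mul_assoc, ← mul_assoc (f i), h i (by simp), one_mul,
      ih fun j hj => h j (by simp [hj])]

theorem prod_mul_prod_reverse_eq_one {R : Type*} [Monoid R] {ι : Type*} (l : List ι) (f g : ι → R)
    (h : ∀ i ∈ l, f i * g i = 1) : (l.map f).prod * (l.map g).reverse.prod = 1 := by
  have := prod_reverse_mul_prod_eq_one l.reverse f g fun i hi => h i (by simpa using hi)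
  simpa [List.map_reverse] using this

theorem stage_neg_mul_stage (H : Fin L → Op N) (t : ℝ) (s : ℝ × Bool) :
    stage H (-t) (s.1, !s.2) * stage H t s = 1 := by
  obtain ⟨a, b⟩ := s
  have h : ∀ l ∈ List.finRange L, evol (H l) (-(a * t)) * evol (H l) (a * t) = 1 :=
    fun l _ => evol_neg_mul_evol _ _
  cases b
  · simpa [stage, List.ofFn_eq_map] using prod_reverse_mul_prod_eq_one _ _ _ h
  · simpa [stage, List.ofFn_eq_map] using prod_mul_prod_reverse_eq_one _ _ _ h

theorem prodFormula_revStages_neg_mul (F : List (ℝ × Bool)) (H : Fin L → Op N) (t : ℝ) :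
    prodFormula (revStages F) H (-t) * prodFormula F H t = 1 := by
  have := prod_reverse_mul_prod_eq_one F (fun s => stage H (-t) (s.1, !s.2)) (stage H t)
    fun s _ => stage_neg_mul_stage H t s
  simpa [prodFormula, revStages, List.map_reverse, Function.comp_def] using this

/-- A symmetric product formula of odd order `2 j + 1` has order `2 j + 2`. -/
theorem HasOrder.succ_of_symmetric {j : ℕ} {F : List (ℝ × Bool)} {H : Fin L → Op N}
    (hF : revStages F = F) (h : HasOrder (2 * j + 1) F H) : HasOrder (2 * j + 2) F H := by
  obtain ⟨E, hE⟩ := h.hasLeadingError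
  -- Symmetry gives `U(-t) U(t) = 1`, while the exponent `2j + 2` is even, so the two leading errors
  -- add up to `2E` instead of cancelling.
  have h1 := (hE.comp_mul (-1)).mul (by omega) hE
  have h2 : E = 0 := by
    have h3 : (fun t : ℝ => (t : ℂ) ^ (2 * j + 1 + 1) • ((-2 : ℂ) • E))
        =O[𝓝 0] fun t : ℝ => t ^ (2 * j + 1 + 1 + 1) := by
      refine h1.congr_left fun t => ?_
      have h4 := prodFormula_revStages_neg_mul F H t
      rw [hF] at h4
      have h5 : ((-1 : ℝ) : ℂ) ^ (2 * j + 1 + 1) = 1 := by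
        push_cast
        exact Even.neg_one_pow ⟨j + 1, by ring⟩
      have h6 : evol (∑ l, H l) 0 = 1 := by simp [evol]
      beta_reduce
      rw [neg_one_mul t, h4, h5, one_smul, ← two_smul ℂ, one_mul, neg_add_cancel, zero_mul, h6,
        sub_self, zero_sub, neg_smul, smul_neg]
    exact (smul_eq_zero.1 (eq_zero_of_pow_smul_isBigO h3)).resolve_left (by norm_num)
  subst h2
  exact hE.hasOrder

theorem revStages_append (F G : List (ℝ × Bool)) :
    revStages (F ++ G) = revStages G ++ revStages F := by
  simp [revStages]

theorem revStages_scale (c : ℝ) (F : List (ℝ × Bool)) :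
    revStages (scale c F) = scale c (revStages F) := by
  simp [revStages, scale, List.map_reverse]

theorem revStages_pf2k (m : ℕ) : revStages (pf2k m) = pf2k m := by
  induction m with
  | zero => simp [revStages, pf2k]
  | succ m ih => simp only [pf2k, revStages_append, revStages_scale, ih, List.append_assoc]

/-- With `r = 4^(1/(2m+3))` one has `1 - 4q = -rq`, whose odd power is `-4 q^(2m+3)`. -/
theorem suzuki_cancellation (m : ℕ) {q : ℝ}
    (hq : q = 1 / (4 - (4 : ℝ) ^ (1 / (2 * (m : ℝ) + 3)))) :
    4 * q ^ (2 * m + 3) + (1 - 4 * q) ^ (2 * m + 3) = 0 := by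
  set r : ℝ := (4 : ℝ) ^ (1 / (2 * (m : ℝ) + 3)) with hr
  have hm : (0 : ℝ) ≤ m := Nat.cast_nonneg m
  have hr4 : r < 4 := by
    calc r < (4 : ℝ) ^ (1 : ℝ) :=
          Real.rpow_lt_rpow_of_exponent_lt (by norm_num) (by rw [div_lt_one] <;> linarith)
      _ = 4 := Real.rpow_one 4
  have hrn : r ^ (2 * m + 3) = 4 := by
    rw [hr, ← Real.rpow_natCast, ← Real.rpow_mul (by norm_num)]
    push_cast
    rw [one_div, inv_mul_cancel₀ (by linarith), Real.rpow_one]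
  have h1 : 1 - 4 * q = -(r * q) := by
    have : 4 - r ≠ 0 := by linarith
    rw [hq]
    field_simp
    ring
  rw [h1, Odd.neg_pow ⟨m + 1, by ring⟩, mul_pow, hrn]
  ring

/-- The five rescaled copies cancel the error of degree `2m + 3`, which gains one order; symmetry
gains the second. -/
theorem hasOrder_pf2k (m : ℕ) (H : Fin L → Op N) : HasOrder (2 * (m + 1)) (pf2k m) H := by
  induction m with
  | zero =>
    have h : HasOrder (2 * 0 + 1) (pf2k 0) H :=
      hasOrder_one_of_sum_eq_one (by norm_num [pf2k]) H
    exact h.succ_of_symmetric (revStages_pf2k 0)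
  | succ m ih =>
    have h : HasOrder (2 * (m + 1) + 1) (pf2k (m + 1)) H := by
      obtain ⟨E, hE⟩ := ih.hasLeadingError
      refine HasLeadingError.hasOrder ?_
      set q : ℝ := 1 / (4 - (4 : ℝ) ^ (1 / (2 * (m : ℝ) + 3))) with hq
      have hn : 1 ≤ 2 * (m + 1) + 1 := by omega
      have h1 := hE.comp_mul q
      have h2 := h1.mul hn h1
      have h3 := (h2.mul hn (hE.comp_mul (1 - 4 * q))).mul hn h2
      have hc := suzuki_cancellation m hq
      convert h3 using 1
      · ext1 t
        simp only [pf2k, prodFormula_append, prodFormula_scale, ← hq]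
      · ring
      · rw [← add_smul, ← add_smul, ← add_smul]
        have hc' : (4 : ℂ) * (q : ℂ) ^ (2 * m + 3) + ((1 - 4 * q : ℝ) : ℂ) ^ (2 * m + 3) = 0 := by
          exact_mod_cast hc
        rw [eq_comm, smul_eq_zero]
        left
        rw [← hc', show 2 * (m + 1) + 1 = 2 * m + 3 by ring]
        ring
    exact h.succ_of_symmetric (revStages_pf2k (m + 1))

theorem hasOrder_pf1 (H : Fin L → Op N) : HasOrder 1 pf1 H :=
  hasOrder_one_of_sum_eq_one (by simp [pf1]) H

end Suzuki

/-! ### Pinsker's inequality relative to the uniform distribution. -/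

section Pinsker

open InformationTheory

theorem two_mul_sub_one_le_add_one_mul_log {x : ℝ} (hx : 1 ≤ x) :
    2 * (x - 1) ≤ (x + 1) * Real.log x := by
  have h := Real.le_log_one_add_of_nonneg (sub_nonneg.2 hx)
  rw [show 1 + (x - 1) = x by ring, show x - 1 + 2 = x + 1 by ring,
    div_le_iff₀ (by linarith)] at h
  linarith

theorem add_one_mul_log_le_two_mul_sub_one {x : ℝ} (hx0 : 0 < x) (hx : x ≤ 1) :
    (x + 1) * Real.log x ≤ 2 * (x - 1) := by
  have h := two_mul_sub_one_le_add_one_mul_log ((one_le_inv₀ hx0).2 hx)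
  rw [Real.log_inv] at h
  have h1 := mul_le_mul_of_nonneg_left h hx0.le
  have h2 : x * x⁻¹ = 1 := mul_inv_cancel₀ hx0.ne'
  have h3 : x * (2 * (x⁻¹ - 1)) = 2 * (x * x⁻¹) - 2 * x := by ring
  have h4 : x * ((x⁻¹ + 1) * -Real.log x) = -((x * x⁻¹ + x) * Real.log x) := by ring
  rw [h3, h4, h2] at h1
  linarith

/-- The difference of the two sides vanishes at `1`, and its derivative `4((x+1) log x - 2(x-1))`
has the sign of `x - 1`. The linear weight is chosen for Cauchy–Schwarz. -/
theorem three_mul_sub_one_sq_le {x : ℝ} (hx : 0 ≤ x) :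
    3 * (x - 1) ^ 2 ≤ (2 * x + 4) * klFun x := by
  set g : ℝ → ℝ := fun x => (2 * x + 4) * klFun x - 3 * (x - 1) ^ 2 with hg
  have hcont : Continuous g := by
    have := continuous_klFun
    fun_prop
  have hd : ∀ y : ℝ, 0 < y → HasDerivAt g (4 * ((y + 1) * Real.log y - 2 * (y - 1))) y := by
    intro y hy
    have h1 := (((hasDerivAt_id y).const_mul 2).add_const 4).mul (hasDerivAt_klFun hy.ne')
    have h2 := ((((hasDerivAt_id y).sub_const 1).pow 2).const_mul 3)
    refine (h1.sub h2).congr_deriv ?_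
    simp [klFun_apply]
    ring
  have h1 : g 1 = 0 := by simp [hg, klFun_one]
  suffices h : g 1 ≤ g x by
    rw [h1] at h
    simp only [hg] at h
    linarith
  rcases le_total 1 x with h | h
  · refine monotoneOn_of_deriv_nonneg (convex_Ici 1) hcont.continuousOn ?_ ?_
      (Set.self_mem_Ici) h h
    · rw [interior_Ici]
      exact fun y hy => (hd y (one_pos.trans hy)).differentiableAt.differentiableWithinAt
    · rw [interior_Ici]
      intro y hy
      rw [(hd y (one_pos.trans hy)).deriv]
      linarith [two_mul_sub_one_le_add_one_mul_log (le_of_lt hy)]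
  · refine antitoneOn_of_deriv_nonpos (convex_Icc 0 1) hcont.continuousOn ?_ ?_
      (Set.mem_Icc.2 ⟨hx, h⟩) (Set.mem_Icc.2 ⟨zero_le_one, le_rfl⟩) h
    · rw [interior_Icc]
      exact fun y hy => (hd y hy.1).differentiableAt.differentiableWithinAt
    · rw [interior_Icc]
      intro y hy
      rw [(hd y hy.1).deriv]
      linarith [add_one_mul_log_le_two_mul_sub_one hy.1 hy.2.le]

/-- **Pinsker's inequality** for a distribution on a finite set and the uniform distribution. -/
theorem sum_abs_sub_inv_card_le {n : Type*} [Fintype n] [Nonempty n] (w : n → ℝ)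
    (h0 : ∀ i, 0 ≤ w i) (h1 : ∑ i, w i = 1) :
    ∑ i, |w i - (Fintype.card n : ℝ)⁻¹|
      ≤ √(2 * Real.log (Fintype.card n) - 2 * ∑ i, Real.negMulLog (w i)) := by
  set d : ℝ := (Fintype.card n : ℝ) with hd
  have hd0 : 0 < d := by rw [hd]; exact_mod_cast Fintype.card_pos
  have hcard : ∑ _i : n, (1 : ℝ) = d := by simp [hd]
  apply Real.le_sqrt_of_sq_le
  have hkl : ∑ i, klFun (d * w i) = d * (Real.log d - ∑ i, Real.negMulLog (w i)) := by
    have h : ∀ i, klFun (d * w i)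
        = d * (Real.log d * w i) - d * Real.negMulLog (w i) + 1 - d * w i := fun i => by
      rw [klFun_apply, Real.negMulLog]
      rcases (h0 i).eq_or_lt with h | h
      · rw [← h]; simp
      · rw [Real.log_mul hd0.ne' h.ne']; ring
    simp only [h, Finset.sum_sub_distrib, Finset.sum_add_distrib, ← Finset.mul_sum, h1, hcard]
    ring
  -- Cauchy–Schwarz with weights `(2x+4)/3` at `x = d w_i`; they sum to `2d` because the `w_i` sum
  -- to `1`.
  have hcs := Finset.sum_sq_le_sum_mul_sum_of_sq_le_mul Finset.univ
    (r := fun i => |d * w i - 1|) (f := fun i => (2 * (d * w i) + 4) / 3)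
    (g := fun i => klFun (d * w i))
    (fun i _ => by have := h0 i; positivity)
    (fun i _ => klFun_nonneg (mul_nonneg hd0.le (h0 i)))
    (fun i _ => by
      have := three_mul_sub_one_sq_le (mul_nonneg hd0.le (h0 i))
      rw [sq_abs]
      linarith)
  have hf : ∑ i, (2 * (d * w i) + 4) / 3 = 2 * d := by
    rw [← Finset.sum_div, Finset.sum_add_distrib, ← Finset.mul_sum, ← Finset.mul_sum, h1,
      show ∑ _i : n, (4 : ℝ) = 4 * d by rw [← hcard, Finset.mul_sum]; simp]
    ring
  have hl : ∑ i, |d * w i - 1| = d * ∑ i, |w i - d⁻¹| := by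
    rw [Finset.mul_sum]
    refine Finset.sum_congr rfl fun i _ => ?_
    rw [← abs_of_pos hd0, ← abs_mul, abs_of_pos hd0, mul_sub, mul_inv_cancel₀ hd0.ne']
  rw [hf, hkl, hl, mul_pow] at hcs
  have hd2 : 0 < d ^ 2 := by positivity
  refine le_of_mul_le_mul_left (hcs.trans_eq ?_) hd2
  ring

end Pinsker

/-! ### Expectations in a density matrix versus the maximally mixed state. -/

section Spectral

open scoped ComplexOrder

variable {n : Type*} [Fintype n] [DecidableEq n]

theorem sum_eigenvector_quadraticForm {ρ : Matrix n n ℂ} (hρ : ρ.IsHermitian) (B : Matrix n n ℂ) :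
    (B * ρ).trace = ∑ i, (hρ.eigenvalues i : ℂ)
        * (star (hρ.eigenvectorBasis i : n → ℂ) ⬝ᵥ B *ᵥ (hρ.eigenvectorBasis i : n → ℂ)) ∧
      B.trace = ∑ i,
        (star (hρ.eigenvectorBasis i : n → ℂ) ⬝ᵥ B *ᵥ (hρ.eigenvectorBasis i : n → ℂ)) := by
  set U : Matrix n n ℂ := (hρ.eigenvectorUnitary : Matrix n n ℂ) with hU
  have hUU : U * star U = 1 := Unitary.mul_star_self_of_mem hρ.eigenvectorUnitary.2
  have hq : ∀ i, (star (hρ.eigenvectorBasis i : n → ℂ) ⬝ᵥ B *ᵥ (hρ.eigenvectorBasis i : n → ℂ))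
      = (star U * (B * U)) i i := fun i => by
    rw [Matrix.mul_apply]
    simp only [dotProduct, Matrix.mulVec, Matrix.mul_apply, hU, Matrix.star_apply,
      Matrix.IsHermitian.eigenvectorUnitary_apply, Pi.star_apply]
  constructor
  · conv_lhs => rw [hρ.spectral_theorem, Unitary.conjStarAlgAut_apply]
    rw [← hU, ← mul_assoc, ← mul_assoc, Matrix.trace_mul_comm, ← mul_assoc, Matrix.trace]
    refine Finset.sum_congr rfl fun i _ => ?_
    rw [Matrix.diag_apply, Matrix.mul_diagonal, hq, mul_comm]
    rfl
  · simp only [hq]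
    change _ = (star U * (B * U)).trace
    rw [Matrix.trace_mul_comm, mul_assoc, hUU, mul_one]

/-- The expectation value in a density matrix differs from the one in the maximally mixed state by
at most the entropy defect. -/
theorem norm_trace_mul_sub_le [Nonempty n] {ρ : Matrix n n ℂ} (hρ : ρ.PosSemidef)
    (h1 : ρ.trace = 1) (B : Matrix n n ℂ) {b : ℝ}
    (hb : ∀ v : EuclideanSpace ℂ n, ‖v‖ = 1 → ‖star (v : n → ℂ) ⬝ᵥ B *ᵥ (v : n → ℂ)‖ ≤ b) :
    ‖(B * ρ).trace - B.trace / Fintype.card n‖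
      ≤ b * √(2 * Real.log (Fintype.card n) - 2 * entropy hρ.isHermitian) := by
  obtain ⟨h2, h3⟩ := sum_eigenvector_quadraticForm hρ.isHermitian B
  have hsum : ∑ i, hρ.isHermitian.eigenvalues i = 1 := by
    have := hρ.isHermitian.trace_eq_sum_eigenvalues
    rw [h1] at this
    apply Complex.ofReal_injective
    push_cast
    exact this.symm
  have hb0 : 0 ≤ b := by
    have i : n := Classical.arbitrary n
    exact (norm_nonneg _).trans (hb (hρ.isHermitian.eigenvectorBasis i)
      (hρ.isHermitian.eigenvectorBasis.orthonormal.1 i))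
  refine le_trans ?_ (mul_le_mul_of_nonneg_left (sum_abs_sub_inv_card_le _
    (fun i => hρ.eigenvalues_nonneg i) hsum) hb0)
  -- In the eigenbasis of `ρ` the difference is `∑ (λ_i - 1/d) ⟨v_i|B|v_i⟩`, so the classical
  -- inequality for the eigenvalues suffices.
  rw [h2, h3, Finset.sum_div, ← Finset.sum_sub_distrib, Finset.mul_sum]
  refine (norm_sum_le _ _).trans (Finset.sum_le_sum fun i _ => ?_)
  rw [div_eq_inv_mul, ← sub_mul, norm_mul, mul_comm]
  gcongr
  · exact hb _ (hρ.isHermitian.eigenvectorBasis.orthonormal.1 i)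
  · rw [← Real.norm_eq_abs, ← Complex.norm_real]
    push_cast
    exact le_rfl

end Spectral

/-! ### Supports, reduced states, and the norm of `A|χ⟩`. -/

section Support

variable {N : ℕ}

/-- `A` acts trivially outside `T`, in terms of its matrix entries. -/
def IsLocalOn (T : Finset (Fin N)) (A : Op N) : Prop :=
  (∀ x y, (∃ i, i ∉ T ∧ x i ≠ y i) → A x y = 0) ∧
    ∀ x y x' y' : Basis N, (∀ i ∈ T, x i = x' i) → (∀ i ∈ T, y i = y' i) →
      (∀ i, i ∉ T → x i = y i) → (∀ i, i ∉ T → x' i = y' i) → A x y = A x' y'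

theorem isLocalOn_localOp (T : Finset (Fin N)) (B : Matrix (T → Fin 2) (T → Fin 2) ℂ) :
    IsLocalOn T (localOp T B) := by
  constructor
  · rintro x y ⟨i, hi, hxy⟩
    rw [localOp, Matrix.of_apply, if_neg]
    exact fun h => hxy (h i hi)
  · intro x y x' y' hx hy hxy hxy'
    rw [localOp, Matrix.of_apply, Matrix.of_apply, if_pos hxy, if_pos hxy']
    congr 1
    · ext1 i; exact hx i i.2
    · ext1 i; exact hy i i.2

theorem IsLocalOn.eq_localOp {T : Finset (Fin N)} {A : Op N} (h : IsLocalOn T A) :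
    ∃ B, A = localOp T B := by
  refine ⟨Matrix.of fun u v => A (glue T u 0) (glue T v 0), ?_⟩
  ext x y
  rw [localOp, Matrix.of_apply, Matrix.of_apply]
  split_ifs with hxy
  · refine h.2 _ _ _ _ (fun i hi => ?_) (fun i hi => ?_) hxy fun i hi => ?_ <;> simp [glue, hi]
  · push Not at hxy
    exact h.1 x y hxy

/-- Passing from `x` to `x'` goes through a hybrid label: first change the qubits outside `T`, then
those outside `T'`. -/
theorem IsLocalOn.inter {T T' : Finset (Fin N)} {A : Op N} (h : IsLocalOn T A)
    (h' : IsLocalOn T' A) : IsLocalOn (T ∩ T') A := by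
  constructor
  · rintro x y ⟨i, hi, hxy⟩
    by_cases hT : i ∈ T
    · exact h'.1 x y ⟨i, fun hT' => hi (Finset.mem_inter.2 ⟨hT, hT'⟩), hxy⟩
    · exact h.1 x y ⟨i, hT, hxy⟩
  · intro x y x' y' hx hy hxy hxy'
    simp only [Finset.mem_inter, not_and] at hx hy hxy hxy'
    rw [h.2 x y (fun i => if i ∈ T then x i else x' i) (fun i => if i ∈ T then y i else y' i)]
    · refine h'.2 _ _ _ _ (fun i hi => ?_) (fun i hi => ?_) (fun i hi => ?_) (fun i hi => ?_)
      · by_cases hT : i ∈ T <;> simp [hT]; exact hx i ⟨hT, hi⟩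
      · by_cases hT : i ∈ T <;> simp [hT]; exact hy i ⟨hT, hi⟩
      · by_cases hT : i ∈ T <;> simp [hT]
        · exact hxy i fun _ => hi
        · exact hxy' i fun h => absurd h hT
      · exact hxy' i fun _ => hi
    · intro i hi; simp [hi]
    · intro i hi; simp [hi]
    · exact fun i hi => hxy i fun h => absurd h hi
    · intro i hi
      simp only [hi, if_false]
      exact hxy' i fun h => absurd h hi

/-- The support is defined one qubit at a time; intersecting the complements of the trivial qubits
makes the locality simultaneous. -/
theorem isLocalOn_supp (A : Op N) : IsLocalOn (supp A) A := by
  classical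
  have h : ∀ s : Finset (Fin N), (∀ i ∈ s, ∃ B, A = localOp {i}ᶜ B) → IsLocalOn sᶜ A := by
    intro s
    induction s using Finset.induction_on with
    | empty =>
      intro _
      rw [Finset.compl_empty]
      refine ⟨fun x y ⟨i, hi, _⟩ => absurd (Finset.mem_univ i) hi, fun x y x' y' hx hy _ _ => ?_⟩
      rw [show x = x' from funext fun i => hx i (Finset.mem_univ i),
        show y = y' from funext fun i => hy i (Finset.mem_univ i)]
    | insert i s _ ih =>
      intro hs
      rw [Finset.insert_eq, Finset.compl_union]
      obtain ⟨B, hB⟩ := hs i (Finset.mem_insert_self i s)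
      refine IsLocalOn.inter ?_ (ih fun j hj => hs j (Finset.mem_insert_of_mem hj))
      rw [hB]
      exact isLocalOn_localOp _ _
  have h1 := h (supp A)ᶜ fun i hi => by
    by_contra hn
    exact Finset.mem_compl.1 hi (Finset.mem_filter.2 ⟨Finset.mem_univ i, hn⟩)
  rwa [compl_compl] at h1

theorem sum_glue {R : Type*} [AddCommMonoid R] (T : Finset (Fin N)) (g : Basis N → R) :
    ∑ x, g x = ∑ u : T → Fin 2, ∑ z : {i // i ∉ T} → Fin 2, g (glue T u z) := by
  rw [← Fintype.sum_prod_type']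
  exact Fintype.sum_equiv (Equiv.piEquivPiSubtypeProd (· ∈ T) fun _ => Fin 2) _ _
    fun x => congrArg g ((Equiv.piEquivPiSubtypeProd (· ∈ T) fun _ => Fin 2).symm_apply_apply x).symm

theorem localOp_glue (T : Finset (Fin N)) (B : Matrix (T → Fin 2) (T → Fin 2) ℂ)
    (u v : T → Fin 2) (z z' : {i // i ∉ T} → Fin 2) :
    localOp T B (glue T u z) (glue T v z') = if z = z' then B u v else 0 := by
  rw [localOp, Matrix.of_apply]
  have h1 : (∀ i, i ∉ T → glue T u z i = glue T v z' i) ↔ z = z' := by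
    constructor
    · intro h
      ext1 ⟨i, hi⟩
      simpa [glue, hi] using h i hi
    · rintro rfl i hi
      simp [glue, hi]
  simp only [h1]
  congr 2 <;> ext1 i <;> simp [glue]

theorem act_apply (A : Op N) (χ : Ket N) (x : Basis N) : act A χ x = ∑ y, A x y * χ y := rfl

theorem inner_act (A : Op N) (χ : Ket N) :
    inner ℂ χ (act A χ) = ∑ x, ∑ y, A x y * (χ y * star (χ x)) := by
  rw [PiLp.inner_apply]
  refine Finset.sum_congr rfl fun x _ => ?_
  rw [RCLike.inner_apply, act_apply, Finset.sum_mul]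
  refine Finset.sum_congr rfl fun y _ => ?_
  rw [mul_assoc]
  rfl

theorem norm_act_le (A : Op N) (χ : Ket N) : ‖act A χ‖ ≤ ‖A‖ * ‖χ‖ := Matrix.l2_opNorm_mulVec A χ

theorem inner_act_localOp (T : Finset (Fin N)) (B : Matrix (T → Fin 2) (T → Fin 2) ℂ) (χ : Ket N) :
    inner ℂ χ (act (localOp T B) χ) = (B * reduced T χ).trace := by
  rw [inner_act, sum_glue T, Matrix.trace]
  refine Finset.sum_congr rfl fun u _ => ?_
  rw [Matrix.diag_apply, Matrix.mul_apply]
  simp only [sum_glue T, localOp_glue, reduced, partialTrace, ketBra, Matrix.of_apply,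
    Finset.mul_sum]
  rw [Finset.sum_comm]
  refine Finset.sum_congr rfl fun v _ => Finset.sum_congr rfl fun z _ => ?_
  simp

theorem trace_localOp (T : Finset (Fin N)) (B : Matrix (T → Fin 2) (T → Fin 2) ℂ) :
    (localOp T B).trace / 2 ^ N = B.trace / Fintype.card (T → Fin 2) := by
  have h1 : (localOp T B).trace = B.trace * Fintype.card ({i // i ∉ T} → Fin 2) := by
    rw [Matrix.trace, sum_glue T, Matrix.trace, Finset.sum_mul]
    refine Finset.sum_congr rfl fun u _ => ?_
    simp [Matrix.diag_apply, localOp_glue, mul_comm]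
  have h2 : (2 : ℂ) ^ N
      = Fintype.card (T → Fin 2) * Fintype.card ({i // i ∉ T} → Fin 2) := by
    have h3 := Fintype.card_congr (Equiv.piEquivPiSubtypeProd (· ∈ T) fun _ : Fin N => Fin 2)
    rw [Fintype.card_prod] at h3
    rw [← Nat.cast_mul]
    have h4 : Fintype.card (Fin N → Fin 2) = 2 ^ N := by simp
    rw [h4] at h3
    rw [← Nat.cast_ofNat, ← Nat.cast_pow]
    exact congrArg Nat.cast h3
  have h5 : (Fintype.card ({i // i ∉ T} → Fin 2) : ℂ) ≠ 0 := by
    exact_mod_cast Fintype.card_ne_zero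
  rw [h1, h2, mul_div_mul_right _ _ h5]

/-- Tensoring `v` with `|0…0⟩` on the other qubits realizes the quadratic form of `B` as an
expectation of `B ⊗ 1`. -/
theorem norm_quadraticForm_le_norm_localOp (T : Finset (Fin N))
    (B : Matrix (T → Fin 2) (T → Fin 2) ℂ) (v : EuclideanSpace ℂ (T → Fin 2)) (hv : ‖v‖ = 1) :
    ‖star (v : (T → Fin 2) → ℂ) ⬝ᵥ B *ᵥ (v : (T → Fin 2) → ℂ)‖ ≤ ‖localOp T B‖ := by
  set χ : Ket N := WithLp.toLp 2 fun x =>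
    if (fun i : {i // i ∉ T} => x i) = 0 then v fun i => x i else 0 with hχ
  have hχg : ∀ u z, χ (glue T u z) = if z = 0 then v u else 0 := by
    intro u z
    have h1 : (fun i : {i // i ∉ T} => glue T u z i) = z := by
      ext1 ⟨i, hi⟩; simp [glue, hi]
    have h2 : (fun i : T => glue T u z i) = u := by
      ext1 ⟨i, hi⟩; simp [glue, hi]
    simp only [hχ, h1, h2]
  have hn : ‖χ‖ = 1 := by
    rw [EuclideanSpace.norm_eq, sum_glue T, ← hv, EuclideanSpace.norm_eq]
    congr 1
    refine Finset.sum_congr rfl fun u _ => ?_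
    simp only [hχg]
    rw [Finset.sum_eq_single 0] <;> simp +contextual
  have hr : ∀ u w, reduced T χ u w = v u * star (v w) := by
    intro u w
    simp only [reduced, partialTrace, ketBra, Matrix.of_apply, hχg]
    rw [Finset.sum_eq_single 0] <;> simp +contextual
  have h1 : star (v : (T → Fin 2) → ℂ) ⬝ᵥ B *ᵥ (v : (T → Fin 2) → ℂ)
      = inner ℂ χ (act (localOp T B) χ) := by
    rw [inner_act_localOp, Matrix.trace]
    refine Finset.sum_congr rfl fun u _ => ?_
    rw [Matrix.diag_apply, Matrix.mul_apply, Matrix.mulVec, dotProduct, Finset.mul_sum]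
    refine Finset.sum_congr rfl fun w _ => ?_
    rw [hr, Pi.star_apply]
    ring
  rw [h1]
  refine (norm_inner_le_norm _ _).trans ?_
  rw [hn, one_mul]
  exact (norm_act_le _ _).trans_eq (by rw [hn, mul_one])

open scoped ComplexOrder in
theorem reduced_posSemidef (T : Finset (Fin N)) (χ : Ket N) : (reduced T χ).PosSemidef := by
  have h : reduced T χ = (Matrix.of fun u z => χ (glue T u z))
      * (Matrix.of fun u z => χ (glue T u z))ᴴ := by
    ext u w
    simp [reduced, partialTrace, ketBra, Matrix.mul_apply, Matrix.conjTranspose_apply]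
  rw [h]
  exact Matrix.posSemidef_self_mul_conjTranspose _

theorem trace_reduced (T : Finset (Fin N)) {χ : Ket N} (hχ : ‖χ‖ = 1) :
    (reduced T χ).trace = 1 := by
  have h : (reduced T χ).trace = inner ℂ χ χ := by
    rw [PiLp.inner_apply, sum_glue T, Matrix.trace]
    rfl
  rw [h, inner_self_eq_norm_sq_to_K, hχ]
  simp

/-- The expectation value of an operator differs from its normalized trace by at most its norm
times the entropy defect of the state on its support. -/
theorem norm_inner_act_sub_trace_le (A : Op N) {χ : Ket N} (hχ : ‖χ‖ = 1) :
    ‖inner ℂ χ (act A χ) - A.trace / 2 ^ N‖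
      ≤ ‖A‖ * √(2 * logDim (supp A) - 2 * entEntropy (supp A) χ) := by
  obtain ⟨B, hB⟩ := (isLocalOn_supp A).eq_localOp
  generalize supp A = T at B hB ⊢
  subst hB
  rw [inner_act_localOp, trace_localOp]
  have h := norm_trace_mul_sub_le (reduced_posSemidef T χ) (trace_reduced T hχ) B
    fun v hv => norm_quadraticForm_le_norm_localOp T B v hv
  have hd : logDim T = Real.log (Fintype.card (T → Fin 2)) := by
    simp [logDim]
  rw [hd]
  exact h

theorem act_mul (A B : Op N) (χ : Ket N) : act (A * B) χ = act A (act B χ) := by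
  simp [act, Matrix.toLpLin_apply]

theorem inner_act_act (A B : Op N) (χ : Ket N) :
    inner ℂ (act A χ) (act B χ) = inner ℂ χ (act (Aᴴ * B) χ) := by
  rw [act_mul, act, act, act, Matrix.toEuclideanLin_conjTranspose_eq_adjoint,
    LinearMap.adjoint_inner_right]

theorem act_sum {J : ℕ} (A : Fin J → Op N) (χ : Ket N) :
    act (∑ j, A j) χ = ∑ j, act (A j) χ := by
  simp [act]

open scoped ComplexOrder in
theorem trace_conjTranspose_mul_self_nonneg (A : Op N) : 0 ≤ (Aᴴ * A).trace :=
  (Matrix.posSemidef_conjTranspose_mul_self A).trace_nonneg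

theorem frobSq_nonneg (A : Op N) : 0 ≤ frobSq A :=
  div_nonneg (Complex.le_def.1 (trace_conjTranspose_mul_self_nonneg A)).1 (by positivity)

theorem frobSq_coe (A : Op N) : ((frobSq A : ℝ) : ℂ) = (Aᴴ * A).trace / 2 ^ N := by
  have h : (((Aᴴ * A).trace.re : ℝ) : ℂ) = (Aᴴ * A).trace := by
    apply Complex.ext
    · simp
    · simpa using (Complex.le_def.1 (trace_conjTranspose_mul_self_nonneg A)).2
  rw [frobSq, Complex.ofReal_div, h]
  push_cast
  rfl

/-- The norm of a vector in terms of the normalized Frobenius norm and the entanglement. -/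
theorem norm_act_le_sqrt {J : ℕ} (A : Fin J → Op N) {χ : Ket N} (hχ : ‖χ‖ = 1) :
    ‖act (∑ j, A j) χ‖ ≤ √(frobSq (∑ j, A j) + entDelta A χ) := by
  apply Real.le_sqrt_of_sq_le
  have h1 : ((‖act (∑ j, A j) χ‖ ^ 2 : ℝ) : ℂ)
      = ∑ j, ∑ j', inner ℂ χ (act ((A j)ᴴ * A j') χ) := by
    have := inner_self_eq_norm_sq_to_K (𝕜 := ℂ) (act (∑ j, A j) χ)
    rw [act_sum, sum_inner] at this
    simp only [inner_sum, inner_act_act] at this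
    rw [this, act_sum]
    simp
  have h2 : ((frobSq (∑ j, A j) : ℝ) : ℂ)
      = ∑ j, ∑ j', ((A j)ᴴ * A j').trace / 2 ^ N := by
    simp only [frobSq_coe, Matrix.conjTranspose_sum, Finset.sum_mul, Finset.mul_sum,
      Matrix.trace_sum, Finset.sum_div]
    exact Finset.sum_comm
  have h3 : ‖((‖act (∑ j, A j) χ‖ ^ 2 - frobSq (∑ j, A j) : ℝ) : ℂ)‖ ≤ entDelta A χ := by
    rw [Complex.ofReal_sub, h1, h2, ← Finset.sum_sub_distrib]
    refine (norm_sum_le _ _).trans (Finset.sum_le_sum fun j _ => ?_)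
    rw [← Finset.sum_sub_distrib]
    exact (norm_sum_le _ _).trans (Finset.sum_le_sum fun j' _ => norm_inner_act_sub_trace_le _ hχ)
  rw [Complex.norm_real] at h3
  linarith [(Real.le_norm_self _).trans h3]

end Support

/-! ### Near-maximal entanglement and the observable error. -/

section ObservableError

variable {N L : ℕ}

theorem frob_sq (A : Op N) : frob A ^ 2 = frobSq A := Real.sq_sqrt (frobSq_nonneg A)

/-- Each square root is at most `√(2κ) f²/s²`, and the weights `‖A_j†A_j'‖` sum to at most `s²`,
which cancels the denominator. -/
theorem NearMaxEntangled.entDelta_le {J : ℕ} {κ : ℝ} (hκ : 0 ≤ κ) {A : Fin J → Op N} {χ : Ket N}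
    (h : NearMaxEntangled κ A χ) : entDelta A χ ≤ √(2 * κ) * frobSq (∑ j, A j) := by
  set f := frob (∑ j, A j) with hf
  set s := ∑ j, ‖A j‖ with hs
  have hs0 : 0 ≤ s := Finset.sum_nonneg fun _ _ => norm_nonneg _
  have h1 : ∀ j j', √(2 * logDim (supp ((A j)ᴴ * A j')) - 2 * entEntropy (supp ((A j)ᴴ * A j')) χ)
      ≤ √(2 * κ) * (f ^ 2 / s ^ 2) := by
    intro j j'
    rw [← Real.sqrt_sq (show 0 ≤ f ^ 2 / s ^ 2 by positivity), ← Real.sqrt_mul (by positivity)]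
    apply Real.sqrt_le_sqrt
    have h2 : 2 * κ * (f ^ 2 / s ^ 2) ^ 2 = 2 * (κ * f ^ 4 / s ^ 4) := by
      rw [div_pow, ← pow_mul, ← pow_mul]
      ring
    rw [h2]
    linarith [h j j']
  have h3 : ∀ c, (∀ j j', √(2 * logDim (supp ((A j)ᴴ * A j'))
      - 2 * entEntropy (supp ((A j)ᴴ * A j')) χ) ≤ c) → entDelta A χ ≤ s ^ 2 * c := by
    intro c hc
    rw [pow_two, hs, Finset.sum_mul_sum, Finset.sum_mul]
    refine Finset.sum_le_sum fun j _ => ?_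
    rw [Finset.sum_mul]
    refine Finset.sum_le_sum fun j' _ => ?_
    refine mul_le_mul ?_ (hc j j') (Real.sqrt_nonneg _) (by positivity)
    exact (norm_mul_le _ _).trans_eq (by rw [Matrix.l2_opNorm_conjTranspose])
  have h2 := h3 _ h1
  refine h2.trans ?_
  rw [← frob_sq, ← hf]
  rcases hs0.eq_or_lt with h0 | h0
  · rw [← h0]
    simp only [ne_eq, OfNat.ofNat_ne_zero, not_false_eq_true, zero_pow, zero_mul]
    positivity
  · refine le_of_eq ?_
    field_simp

theorem NearMaxEntangled.sqrt_le {J : ℕ} {κ : ℝ} (hκ : 0 ≤ κ) {A : Fin J → Op N} {χ : Ket N}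
    (h : NearMaxEntangled κ A χ) :
    √(frobSq (∑ j, A j) + entDelta A χ) ≤ √(1 + √(2 * κ)) * frob (∑ j, A j) := by
  rw [frob, ← Real.sqrt_mul (by positivity)]
  apply Real.sqrt_le_sqrt
  linarith [h.entDelta_le hκ]

theorem evol_conjTranspose {A : Op N} (hA : A.IsHermitian) (t : ℝ) :
    (evol A t)ᴴ = evol A (-t) := by
  rw [evol, ← Matrix.exp_conjTranspose, Matrix.conjTranspose_smul, hA.eq, evol]
  congr 2
  simp

theorem evol_mem_unitary {A : Op N} (hA : A.IsHermitian) (t : ℝ) :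
    evol A t ∈ unitary (Op N) := by
  rw [Unitary.mem_iff, Matrix.star_eq_conjTranspose, evol_conjTranspose hA]
  exact ⟨evol_neg_mul_evol A t, evol_mul_evol_neg A t⟩

theorem prodFormula_mem_unitary (F : List (ℝ × Bool)) {H : Fin L → Op N}
    (hH : ∀ l, (H l).IsHermitian) (t : ℝ) : prodFormula F H t ∈ unitary (Op N) := by
  refine Submonoid.list_prod_mem _ fun U hU => ?_
  obtain ⟨⟨a, b⟩, -, rfl⟩ := List.mem_map.1 hU
  have h : ∀ V ∈ List.ofFn fun l => evol (H l) (a * t), V ∈ unitary (Op N) := by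
    intro V hV
    obtain ⟨l, rfl⟩ := List.mem_ofFn.1 hV
    exact evol_mem_unitary (hH l) _
  cases b
  · exact Submonoid.list_prod_mem _ h
  · exact Submonoid.list_prod_mem _ fun V hV => h V (List.mem_reverse.1 hV)

theorem norm_act_of_mem_unitary {U : Op N} (hU : U ∈ unitary (Op N)) (χ : Ket N) :
    ‖act U χ‖ = ‖χ‖ := by
  have h : inner ℂ (act U χ) (act U χ) = inner ℂ χ χ := by
    rw [inner_act_act, ← Matrix.star_eq_conjTranspose, Unitary.star_mul_self_of_mem hU]
    simp [act]
  rw [inner_self_eq_norm_sq_to_K, inner_self_eq_norm_sq_to_K] at h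
  have h1 : ‖act U χ‖ ^ 2 = ‖χ‖ ^ 2 := by exact_mod_cast h
  exact (pow_left_inj₀ (norm_nonneg _) (norm_nonneg _) two_ne_zero).1 h1

theorem norm_act_heisenberg {H : Op N} (hH : H.IsHermitian) (O : Op N) (t : ℝ) (χ : Ket N) :
    ‖act (heisenberg H O t) χ‖ = ‖act O (act (evol H t) χ)‖ := by
  rw [heisenberg, mul_assoc, act_mul, norm_act_of_mem_unitary (evol_mem_unitary hH _), act_mul]

theorem norm_act_heisenberg_le {H : Op N} (hH : H.IsHermitian) (O : Op N) (t : ℝ) (χ : Ket N) :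
    ‖act (heisenberg H O t) χ‖ ≤ ‖O‖ * ‖χ‖ := by
  rw [norm_act_heisenberg hH]
  exact (norm_act_le _ _).trans_eq (by rw [norm_act_of_mem_unitary (evol_mem_unitary hH _)])

theorem act_sub (A B : Op N) (χ : Ket N) : act (A - B) χ = act A χ - act B χ := by
  simp [act]

theorem act_add (A B : Op N) (χ : Ket N) : act (A + B) χ = act A χ + act B χ := by
  simp [act]

theorem act_smul (c : ℂ) (A : Op N) (χ : Ket N) : act (c • A) χ = c • act A χ := by
  simp [act]

theorem act_vec_add (A : Op N) (χ φ : Ket N) : act A (χ + φ) = act A χ + act A φ := by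
  simp [act]

theorem act_vec_smul (A : Op N) (c : ℂ) (χ : Ket N) : act A (c • χ) = c • act A χ := by
  simp [act]

/-- This also holds for `χ = 0`, which is why normalizing the zero vector to zero is harmless. -/
theorem norm_act_eq_norm_mul (A : Op N) (χ : Ket N) :
    ‖act A χ‖ = ‖χ‖ * ‖act A (NormedSpace.normalize χ)‖ := by
  conv_lhs => rw [← NormedSpace.norm_smul_normalize χ]
  rw [RCLike.real_smul_eq_coe_smul (K := ℂ), act_vec_smul, norm_smul]
  simp

theorem obsError_le_commutator (F : List (ℝ × Bool)) {H : Fin L → Op N}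
    (hH : ∀ l, (H l).IsHermitian) (O : Op N) {ψ : Ket N} (hψ : ‖ψ‖ = 1) (t : ℝ) :
    obsError F H O ψ t ≤ ‖act (multError F H t) (act (heisenberg (∑ l, H l) O t) ψ)‖
      + ‖act (heisenberg (∑ l, H l) O t) (act (multError F H t) ψ)‖ := by
  have hS : (∑ l, H l).IsHermitian := by
    rw [Matrix.IsHermitian, Matrix.conjTranspose_sum]
    exact Finset.sum_congr rfl fun l _ => (hH l).eq
  set E := evol (∑ l, H l) (-t) with hE
  set E' := evol (∑ l, H l) t with hE'
  set U := prodFormula F H t with hU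
  set W := E * U with hW
  have hWu : W ∈ unitary (Op N) :=
    mul_mem (evol_mem_unitary hS _) (prodFormula_mem_unitary F hH t)
  have hWW : Wᴴ * W = 1 := Unitary.star_mul_self_of_mem hWu
  have hUW : U = E' * W := by
    rw [hW, ← mul_assoc, hE, hE', evol_mul_evol_neg, one_mul]
  have hEE : E'ᴴ = E := evol_conjTranspose hS t
  have hm : multError F H t = W - 1 := rfl
  have hO : heisenberg (∑ l, H l) O t = E * O * E' := rfl
  rw [hm, hO, obsError, hO, ← hU]
  have key : E * O * E' - Uᴴ * O * U
      = Wᴴ * ((W - 1) * (E * O * E') - (E * O * E') * (W - 1)) := by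
    have h1 : Uᴴ * O * U = Wᴴ * (E * O * E' * W) := by
      rw [hUW, Matrix.conjTranspose_mul, hEE]
      simp only [mul_assoc]
    rw [h1]
    generalize E * O * E' = Q
    have h2 : Wᴴ * ((W - 1) * Q - Q * (W - 1)) = Wᴴ * W * Q - Wᴴ * (Q * W) := by noncomm_ring
    rw [h2, hWW, one_mul]
  -- The factor `W†` moves to the bra, where unitarity keeps the norm of `ψ`.
  rw [key, ← inner_act_act, act_sub, act_mul (W - 1), act_mul (E * O * E')]
  refine (norm_inner_le_norm _ _).trans ?_
  rw [norm_act_of_mem_unitary hWu, hψ, one_mul]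
  exact norm_sub_le _ _

/-- Normalizing the intermediate vectors `O(t)ψ` and `Mψ` turns each leading term into a product of
two norms. The remainder costs `‖O‖ r` in each of the two orderings. -/
theorem obsError_le_of_multError (F : List (ℝ × Bool)) {H : Fin L → Op N}
    (hH : ∀ l, (H l).IsHermitian) (O M : Op N) {ψ : Ket N} (hψ : ‖ψ‖ = 1) {t r : ℝ} (ht : 0 < t)
    {n : ℕ} (hM : ‖multError F H t - (t : ℂ) ^ n • M‖ ≤ r) :
    obsError F H O ψ t ≤
      (‖act O (psiT (∑ l, H l) ψ t)‖ * ‖act M (psiO (∑ l, H l) O ψ t)‖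
        + ‖act O (psiUM (∑ l, H l) M ψ t)‖ * ‖act M ψ‖) * t ^ n + 2 * ‖O‖ * r := by
  have hS : (∑ l, H l).IsHermitian := by
    rw [Matrix.IsHermitian, Matrix.conjTranspose_sum]
    exact Finset.sum_congr rfl fun l _ => (hH l).eq
  set Q := heisenberg (∑ l, H l) O t with hQ
  set R := multError F H t - (t : ℂ) ^ n • M with hR
  have hr : 0 ≤ r := (norm_nonneg _).trans hM
  have hm : multError F H t = (t : ℂ) ^ n • M + R := by rw [hR]; abel
  have htn : ‖(t : ℂ) ^ n‖ = t ^ n := by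
    rw [norm_pow, Complex.norm_real, Real.norm_eq_abs, abs_of_pos ht]
  have hRv : ∀ v : Ket N, ‖act R v‖ ≤ r * ‖v‖ := fun v =>
    (norm_act_le _ _).trans (mul_le_mul_of_nonneg_right hM (norm_nonneg _))
  have hQψ : ‖act Q ψ‖ ≤ ‖O‖ := by
    simpa [hψ] using norm_act_heisenberg_le hS O t ψ
  have h1 : ‖act (multError F H t) (act Q ψ)‖ ≤
      t ^ n * (‖act O (psiT (∑ l, H l) ψ t)‖ * ‖act M (psiO (∑ l, H l) O ψ t)‖) + r * ‖O‖ := by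
    rw [hm, act_add, act_smul]
    refine (norm_add_le _ _).trans (add_le_add (le_of_eq ?_) ?_)
    · rw [norm_smul, htn, norm_act_eq_norm_mul, hQ, norm_act_heisenberg hS]
      rfl
    · exact (hRv _).trans (mul_le_mul_of_nonneg_left hQψ hr)
  have h2 : ‖act Q (act (multError F H t) ψ)‖ ≤
      t ^ n * (‖act O (psiUM (∑ l, H l) M ψ t)‖ * ‖act M ψ‖) + r * ‖O‖ := by
    rw [hm, act_add, act_smul, act_vec_add, act_vec_smul]
    refine (norm_add_le _ _).trans (add_le_add (le_of_eq ?_) ?_)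
    · rw [norm_smul, htn, norm_act_eq_norm_mul Q, hQ, norm_act_heisenberg hS,
        mul_comm ‖act M ψ‖]
      rfl
    · refine (norm_act_heisenberg_le hS O t _).trans ?_
      rw [mul_comm]
      gcongr
      simpa [hψ] using hRv ψ
  calc obsError F H O ψ t ≤ _ := obsError_le_commutator F hH O hψ t
    _ ≤ _ := add_le_add h1 h2
    _ = _ := by ring

theorem norm_act_normalize_le {J : ℕ} (A : Fin J → Op N) {U : Op N} (hU : U ∈ unitary (Op N))
    (χ : Ket N) : ‖act (∑ j, A j) (act U (NormedSpace.normalize χ))‖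
      ≤ √(frobSq (∑ j, A j) + entDelta A (act U (NormedSpace.normalize χ))) := by
  rcases eq_or_ne χ 0 with rfl | h
  · simp [act]
  · apply norm_act_le_sqrt
    rw [norm_act_of_mem_unitary hU, NormedSpace.norm_normalize h]

end ObservableError

end Trotter

/-! ### Assembly of the main theorem. -/

theorem mainTheorem4 :
    -- the standard product formulas have the orders after which they are named
    (∀ (N L : ℕ) (H : Fin L → Op N), (∀ l, (H l).IsHermitian) →
      HasOrder 1 pf1 H ∧ ∀ m : ℕ, HasOrder (2 * (m + 1)) (pf2k m) H) ∧
    -- the bound for every product formula of order `p`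
    (∀ (p : ℕ) (F : List (ℝ × Bool)), 1 ≤ p → ∃ C : ℝ,
      ∀ (N L : ℕ) (H : Fin L → Op N), (∀ l, (H l).IsHermitian) → HasOrder p F H →
      ∃ (M : Op N) (t₀ : ℝ), 0 < t₀ ∧
        -- `M` is the leading coefficient of the multiplicative error
        (∀ t : ℝ, 0 < t → t ≤ t₀ →
          ‖multError F H t - (t : ℂ) ^ (p + 1) • M‖ ≤ C * alpha (p + 1) H * t ^ (p + 2)) ∧
        ∀ (J K : ℕ) (O : Fin J → Op N) (Mj : Fin K → Op N),
          (∑ j, O j).IsHermitian → ∑ j, Mj j = M →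
          ∀ ψ : Ket N, ‖ψ‖ = 1 → ∀ t : ℝ, 0 < t → t ≤ t₀ →
            obsError F H (∑ j, O j) ψ t ≤
              (√(frobSq (∑ j, O j) + entDelta O (psiT (∑ l, H l) ψ t))
                  * √(frobSq M + entDelta Mj (psiO (∑ l, H l) (∑ j, O j) ψ t))
                + √(frobSq (∑ j, O j) + entDelta O (psiUM (∑ l, H l) M ψ t))
                  * √(frobSq M + entDelta Mj ψ)) * t ^ (p + 1)
              + 2 * C * ‖∑ j, O j‖ * alpha (p + 1) H * t ^ (p + 2) ∧
            -- near-maximal local entanglement gives scaling with the normalized Frobenius norms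
            ∀ κ : ℝ, 0 ≤ κ →
              NearMaxEntangled κ O (psiT (∑ l, H l) ψ t) →
              NearMaxEntangled κ Mj (psiO (∑ l, H l) (∑ j, O j) ψ t) →
              NearMaxEntangled κ O (psiUM (∑ l, H l) M ψ t) →
              NearMaxEntangled κ Mj ψ →
              obsError F H (∑ j, O j) ψ t ≤
                2 * (1 + √(2 * κ)) * frob (∑ j, O j) * frob M * t ^ (p + 1)
                + 2 * C * ‖∑ j, O j‖ * alpha (p + 1) H * t ^ (p + 2)) := by
  refine ⟨fun N L H _ => ⟨hasOrder_pf1 H, fun m => hasOrder_pf2k m H⟩, fun p F hp => ?_⟩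
  obtain ⟨C, -, hC⟩ := exists_multError_bound hp F
  refine ⟨C, fun N L H hH ho => ?_⟩
  obtain ⟨M, t₀, ht₀, hM⟩ := hC N L H hH ho
  refine ⟨M, t₀, ht₀, hM, fun J K O Mj _ hMj ψ hψ t ht htt => ?_⟩
  have hS : (∑ l, H l).IsHermitian := by
    rw [Matrix.IsHermitian, Matrix.conjTranspose_sum]
    exact Finset.sum_congr rfl fun l _ => (hH l).eq
  have hT : ‖psiT (∑ l, H l) ψ t‖ = 1 := by
    rw [psiT, norm_act_of_mem_unitary (evol_mem_unitary hS _), hψ]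
  have h1 := norm_act_le_sqrt O hT
  have h2 : ‖act M (psiO (∑ l, H l) (∑ j, O j) ψ t)‖
      ≤ √(frobSq M + entDelta Mj (psiO (∑ l, H l) (∑ j, O j) ψ t)) := by
    -- No evolution follows the normalization in `psiO`, so the unitary is `1`.
    have := norm_act_normalize_le Mj (one_mem (unitary (Op N)))
      (act (heisenberg (∑ l, H l) (∑ j, O j) t) ψ)
    rw [hMj] at this
    simpa [act, psiO] using this
  have h3 : ‖act (∑ j, O j) (psiUM (∑ l, H l) M ψ t)‖
      ≤ √(frobSq (∑ j, O j) + entDelta O (psiUM (∑ l, H l) M ψ t)) :=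
    norm_act_normalize_le O (evol_mem_unitary hS t) (act M ψ)
  have h4 : ‖act M ψ‖ ≤ √(frobSq M + entDelta Mj ψ) := by
    have := norm_act_le_sqrt Mj hψ
    rwa [hMj] at this
  have hmain := obsError_le_of_multError F hH (∑ j, O j) M hψ ht (hM t ht htt)
  have hb : obsError F H (∑ j, O j) ψ t ≤
      (√(frobSq (∑ j, O j) + entDelta O (psiT (∑ l, H l) ψ t))
          * √(frobSq M + entDelta Mj (psiO (∑ l, H l) (∑ j, O j) ψ t))
        + √(frobSq (∑ j, O j) + entDelta O (psiUM (∑ l, H l) M ψ t))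
          * √(frobSq M + entDelta Mj ψ)) * t ^ (p + 1)
      + 2 * C * ‖∑ j, O j‖ * alpha (p + 1) H * t ^ (p + 2) := by
    refine hmain.trans (add_le_add (mul_le_mul_of_nonneg_right ?_ (by positivity))
      (le_of_eq (by ring)))
    exact add_le_add (mul_le_mul h1 h2 (norm_nonneg _) (Real.sqrt_nonneg _))
      (mul_le_mul h3 h4 (norm_nonneg _) (Real.sqrt_nonneg _))
  refine ⟨hb, fun κ hκ k1 k2 k3 k4 => hb.trans (add_le_add ?_ le_rfl)⟩
  have e1 := k1.sqrt_le hκ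
  have e2 := k2.sqrt_le hκ
  have e3 := k3.sqrt_le hκ
  have e4 := k4.sqrt_le hκ
  rw [hMj] at e2 e4
  -- Each product pairs an `O`-factor with an `M`-factor, each carrying one such square root.
  have hq : √(1 + √(2 * κ)) * √(1 + √(2 * κ)) = 1 + √(2 * κ) :=
    Real.mul_self_sqrt (by positivity)
  have hf : ∀ A : Op N, 0 ≤ frob A := fun A => Real.sqrt_nonneg _
  calc _ ≤ ((√(1 + √(2 * κ)) * frob (∑ j, O j)) * (√(1 + √(2 * κ)) * frob M)
        + (√(1 + √(2 * κ)) * frob (∑ j, O j)) * (√(1 + √(2 * κ)) * frob M)) * t ^ (p + 1) := by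
        have h0 : 0 ≤ √(1 + √(2 * κ)) * frob (∑ j, O j) :=
          mul_nonneg (Real.sqrt_nonneg _) (hf _)
        exact mul_le_mul_of_nonneg_right (add_le_add
          (mul_le_mul e1 e2 (Real.sqrt_nonneg _) h0)
          (mul_le_mul e3 e4 (Real.sqrt_nonneg _) h0)) (by positivity)
    _ = 2 * (√(1 + √(2 * κ)) * √(1 + √(2 * κ))) * frob (∑ j, O j) * frob M * t ^ (p + 1) := by
        ring
    _ = _ := by rw [hq]
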